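/- Let $0<\alpha<1$, $1<\beta\le 2$, $\kappa>0$, $x_L<x_R$, $T>0$. For positive integers $N,M$ put $h=(x_R-x_L)/N$, $\tau=T/M$, $x_i=x_L+ih$, $t_j=j\tau$. For $\ell\ge 0$ let $$a_\ell=(\ell+1)^{1-\alpha}-\ell^{1-\alpha},\qquad b_\ell=\tfrac{1}{2-\alpha}\big[(\ell+1)^{2-\alpha}-\ell^{2-\alpha}\big]-\tfrac12\big[(\ell+1)^{1-\alpha}+\ell^{1-\alpha}\big],$$ and for $j\ge1$ define $c^{(j)}_s$, $0\le s\le j$, as follows. If $j=1$: $c^{(1)}_0=a_0+b_0+b_1$ and $c^{(1)}_1=a_1-b_1-b_0$. If $j\ge2$: $c^{(j)}_0=a_0+b_0$, $c^{(j)}_s=a_s+b_s-b_{s-1}$ for $1\le s\le j-2$, $c^{(j)}_{j-1}=a_{j-1}+b_{j-1}+b_j-b_{j-2}$, and $c^{(j)}_j=a_j-b_j-b_{j-1}$. Put $$\delta_t^\alpha y^{j+1}=\frac{\tau^{-\alpha}}{\Gamma(2-\alpha)}\sum_{s=0}^{j}c^{(j)}_{j-s}\,(y^{s+1}-y^s),\qquad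 \delta_x^\beta v_i=-h^{-\beta}\sum_{k=i-N}^{i}g_k\,v_{i-k},\qquad g_k=\frac{(-1)^k\,\Gamma(1+\beta)}{\Gamma(\beta/2-k+1)\,\Gamma(\beta/2+k+1)}$$ (with $1/\Gamma=0$ at the poles of $\Gamma$). For given functions $f(x,t)$ and $\phi(x)$, a solution of the L2-type scheme is a family of reals $u_i^j$ ($0\le i\le N$, $0\le j\le M$) with $$\delta_t^\alpha u_i^{j+1}=\kappa\,\delta_x^\beta u_i^{j+1}+f_i^{j+1}\qquad(1\le i\le N-1,\ 1\le j\le M-1),\qquad f_i^j=f(x_i,t_j),$$ $u_0^j=u_N^j=0$ for $0\le j\le M$, and $u_i^0=\phi(x_i)$ for $1\le i\le N-1$ (the values $u_i^1$ are arbitrary). Write $\mathbf u^j=(u_1^j,\dots,u_{N-1}^j)^T$, $\mathbf f^j=(f_1^j,\dots,f_{N-1}^j)^T$ and $\|\mathbf v\|^2=h\sum_{i=1}^{N-1}v_i^2$. On grid functions vanishing at $x_0$ and $x_N$, identified with $\mathbb R^{N-1}$, the operator $-\delta_x^\beta$ has a symmetric positive semidefinite square root $\Xi^\beta$. There is a constant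 $C_1>0$, depending only on $\alpha,\beta,\kappa,x_L,x_R,T$ (in particular independent of $\tau$ and $h$), such that for all positive integers $N,M$, all $f,\phi$, and every solution of the scheme, $$\tau\sum_{j=1}^{M-1}\Big(\|\mathbf u^{j+1}\|^2+\|\Xi^\beta\mathbf u^{j+1}\|^2\Big)\le C_1\Big(\|\mathbf u^1\|^2+\|\mathbf u^0\|^2+\tau\sum_{j=1}^{M-1}\|\mathbf f^{j+1}\|^2\Big).$$ -/

import Mathlib

noncomputable section

namespace L2Scheme

/-! ### The L2 formula for the Caputo derivative -/

/-- `a_ℓ = (ℓ+1)^{1-α} - ℓ^{1-α}`. -/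
def a (α : ℝ) (l : ℕ) : ℝ := ((l : ℝ) + 1) ^ (1 - α) - (l : ℝ) ^ (1 - α)

/-- `b_ℓ = ((ℓ+1)^{2-α} - ℓ^{2-α}) / (2-α) - ((ℓ+1)^{1-α} + ℓ^{1-α}) / 2`. -/
def b (α : ℝ) (l : ℕ) : ℝ :=
  1 / (2 - α) * (((l : ℝ) + 1) ^ (2 - α) - (l : ℝ) ^ (2 - α))
    - 1 / 2 * (((l : ℝ) + 1) ^ (1 - α) + (l : ℝ) ^ (1 - α))

/-- The coefficient `c_s` (for `0 ≤ s ≤ j`) of the L2 formula at the time level `t_{j+1}`,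
`j ≥ 1`. It depends on `j`, because the last two of the coefficients are special. -/
def c (α : ℝ) (j s : ℕ) : ℝ :=
  if j = 1 then
    if s = 0 then a α 0 + b α 0 + b α 1 else a α 1 - b α 1 - b α 0
  else if s = 0 then a α 0 + b α 0
  else if s = j then a α j - b α j - b α (j - 1)
  else if s = j - 1 then a α (j - 1) + b α (j - 1) + b α j - b α (j - 2)
  else a α s + b α s - b α (s - 1)

/-- The discrete Caputo derivative `δ_t^α y(t_{j+1})` with step `τ` of a sequence `y`
of values at `t_0, t_1, …`. -/
def deltaT (α τ : ℝ) (y : ℕ → ℝ) (j : ℕ) : ℝ :=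
  τ ^ (-α) / Real.Gamma (2 - α) *
    ∑ s ∈ Finset.range (j + 1), c α j (j - s) * (y (s + 1) - y s)

/-! ### The fractional centred difference for the Riesz derivative -/

/-- `g_k = (-1)^k Γ(1+β) / (Γ(β/2-k+1) Γ(β/2+k+1))`, for `k ∈ ℤ`. As usual `1/Γ = 0` at the
poles of `Γ`; this matters for `β = 2` only, and agrees with Mathlib's values of
`Real.Gamma` and of division at these points. -/
def g (β : ℝ) (k : ℤ) : ℝ :=
  (-1 : ℝ) ^ k * Real.Gamma (1 + β) /
    (Real.Gamma (β / 2 - k + 1) * Real.Gamma (β / 2 + k + 1))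

/-- `(δ_x^β v)_i = -h^{-β} ∑_{k=i-N}^{i} g_k v_{i-k}` for a grid function `v_0, …, v_N`.
The sum is written over `m = i - k`, which runs through `0, …, N`. -/
def deltaX (β h : ℝ) (N : ℕ) (v : ℕ → ℝ) (i : ℕ) : ℝ :=
  -h ^ (-β) * ∑ m ∈ Finset.range (N + 1), g β ((i : ℤ) - (m : ℤ)) * v m

/-- The vector `(v_1, …, v_{N-1})` of the interior values of a grid function. -/
def interior (N : ℕ) (v : ℕ → ℝ) : Fin (N - 1) → ℝ := fun i => v ((i : ℕ) + 1)

/-- The matrix of `-δ_x^β` on the interior values of the grid functions that vanish at both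
ends: `h^{-β}` times the Toeplitz matrix `(g_{i-j})` of order `N - 1`. -/
def negDeltaXMatrix (β h : ℝ) (N : ℕ) : Matrix (Fin (N - 1)) (Fin (N - 1)) ℝ :=
  Matrix.of fun i j => h ^ (-β) * g β (((i : ℕ) : ℤ) - ((j : ℕ) : ℤ))

/-- `negDeltaXMatrix` does represent `-δ_x^β`. -/
theorem negDeltaXMatrix_mulVec (β h : ℝ) {N : ℕ} (hN : 0 < N) (v : ℕ → ℝ)
    (h0 : v 0 = 0) (h1 : v N = 0) :
    (negDeltaXMatrix β h N).mulVec (interior N v)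
      = interior N (fun i => -deltaX β h N v i) := by
  obtain ⟨n, rfl⟩ : ∃ n, N = n + 1 := ⟨N - 1, by omega⟩
  funext i
  simp only [negDeltaXMatrix, interior, deltaX, Matrix.mulVec, dotProduct, Matrix.of_apply]
  rw [Finset.sum_range_succ, h1, Finset.sum_range_succ', h0, mul_zero, mul_zero, add_zero,
    add_zero, neg_mul, neg_neg, Finset.mul_sum]
  rw [← Fin.sum_univ_eq_sum_range (fun m => h ^ (-β) *
    (g β (((((i : ℕ) + 1 : ℕ)) : ℤ) - ((m + 1 : ℕ) : ℤ)) * v (m + 1))) n]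
  refine Finset.sum_congr rfl fun m _ => ?_
  push_cast
  rw [add_sub_add_right_eq_sub, mul_assoc]

open scoped MatrixOrder in
/-- `Ξ^β`, the (positive semidefinite) square root of `-δ_x^β`. -/
def Xi (β h : ℝ) (N : ℕ) : Matrix (Fin (N - 1)) (Fin (N - 1)) ℝ :=
  CFC.sqrt (negDeltaXMatrix β h N)

/-! ### Discrete inner product and norm -/

/-- `(v, w) = h ∑_{i=1}^{N-1} v_i w_i`, for vectors of interior values. -/
def discInner (h : ℝ) {n : ℕ} (v w : Fin n → ℝ) : ℝ := h * ∑ i, v i * w i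

/-- `‖v‖ = √(v, v)`. -/
def discNorm (h : ℝ) {n : ℕ} (v : Fin n → ℝ) : ℝ := Real.sqrt (discInner h v v)

/-! ### The scheme -/

/-- `u i j = u_i^j` (`0 ≤ i ≤ N`, `0 ≤ j ≤ M`) solves the L2-type difference scheme with
`N` space and `M` time steps, source `f x t` and initial value `φ`. The values `u_i^1` are
not determined by the scheme. -/
structure IsSolution (α β κ xL xR T : ℝ) (N M : ℕ) (f : ℝ → ℝ → ℝ) (φ : ℝ → ℝ)
    (u : ℕ → ℕ → ℝ) : Prop where
  scheme : ∀ i j : ℕ, 1 ≤ i → i ≤ N - 1 → 1 ≤ j → j ≤ M - 1 →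
    deltaT α (T / M) (u i) j =
      κ * deltaX β ((xR - xL) / N) N (fun m => u m (j + 1)) i
        + f (xL + i * ((xR - xL) / N)) (((j + 1 : ℕ) : ℝ) * (T / M))
  boundary_left : ∀ j ≤ M, u 0 j = 0
  boundary_right : ∀ j ≤ M, u N j = 0
  initial : ∀ i : ℕ, 1 ≤ i → i ≤ N - 1 → u i 0 = φ (xL + i * ((xR - xL) / N))

/-- The vector `u^j = (u_1^j, …, u_{N-1}^j)`. -/
def uVec (N : ℕ) (u : ℕ → ℕ → ℝ) (j : ℕ) : Fin (N - 1) → ℝ := interior N fun i => u i j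

/-- The vector `f^j = (f_1^j, …, f_{N-1}^j)` with `f_i^j = f(x_i, t_j)`. -/
def fVec (xL h τ : ℝ) (N : ℕ) (f : ℝ → ℝ → ℝ) (j : ℕ) : Fin (N - 1) → ℝ :=
  interior N fun i => f (xL + i * h) (j * τ)

end L2Scheme

end

noncomputable section

namespace L2Scheme

open Finset

/-! Pairing the scheme at level `j + 1` with `u^{j+1}` gives an energy identity: a time form
(`timeForm`, summed over space) plus `κ‖Ξ u^{j+1}‖²` equals the pairing with the source. Everything
rests on a lower bound for the sum of the time forms.

If the weights on the increments were nonnegative and nonincreasing in age, Abel summation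
(`mul_sum_weights_ge`) would replace each time form by a weighted sum of increments of `y²`. The
term `-b 0` in `c_1` spoils this: as `α → 1`, `c_1` tends to `-1/2`. The remedy is to write `c_0 = λ
+ 3θ`, `c_1 = λ - θ`, with `λ` = `leadWeight`, `θ` = `bdfWeight`. The `θ` part is a two-step
backward difference, whose pairing telescopes up to a square. The rest is monotone because `θ ≥ 0`
is not needed there, only `λ ≥ c_2` (`c_zero_add_three_c_one`) and the decay of `a` and `b`; the
sign of `θ` (`c_one_le_c_zero`) serves the telescoping part.

Summation over levels then telescopes as well (`sum_timeForm_ge`). The surviving weights are at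
least a multiple of `M^{-α}`, which combines with `τ^{-α}` to a multiple of `T^{-α}`: this controls
`τ ∑ ‖u‖²` with no Poincaré inequality. The argument needs `j ≥ 4`; the levels `j ≤ 3` are estimated
crudely one at a time (`exists_levels_le`).

In space, the Toeplitz matrix has nonpositive off-diagonal entries and nonnegative row sums, so it
is positive semidefinite and its square root squares back to it. -/

/-! ### Calculus: trapezoidal error and differences of powers. -/

theorem nonneg_of_second_deriv_nonneg {F F' F'' : ℝ → ℝ}
    (h1 : ∀ t ∈ Set.Icc (0 : ℝ) 1, HasDerivAt F (F' t) t)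
    (h2 : ∀ t ∈ Set.Icc (0 : ℝ) 1, HasDerivAt F' (F'' t) t)
    (h3 : ∀ t ∈ Set.Icc (0 : ℝ) 1, 0 ≤ F'' t) (h0 : 0 ≤ F 0) (h0' : 0 ≤ F' 0) : 0 ≤ F 1 := by
  have mono : ∀ {G G' : ℝ → ℝ}, (∀ t ∈ Set.Icc (0 : ℝ) 1, HasDerivAt G (G' t) t) →
      (∀ t ∈ Set.Icc (0 : ℝ) 1, 0 ≤ G' t) → ∀ t ∈ Set.Icc (0 : ℝ) 1, G 0 ≤ G t := by
    intro G G' hG hG' t ht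
    have hm : MonotoneOn G (Set.Icc (0 : ℝ) 1) := by
      refine monotoneOn_of_deriv_nonneg (convex_Icc 0 1)
        (fun x hx => (hG x hx).continuousAt.continuousWithinAt)
        (fun x hx => (hG x (interior_subset hx)).differentiableAt.differentiableWithinAt) ?_
      intro x hx
      rw [(hG x (interior_subset hx)).deriv]
      exact hG' x (interior_subset hx)
    exact hm (Set.left_mem_Icc.2 zero_le_one) ht ht.1
  have hF' : ∀ t ∈ Set.Icc (0 : ℝ) 1, 0 ≤ F' t := fun t ht => h0'.trans (mono h2 h3 t ht)
  exact h0.trans (mono h1 hF' 1 (Set.right_mem_Icc.2 zero_le_one))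

/-- The error of the trapezoidal rule for `x ↦ x ^ q` on `[x, x + t]`. -/
def trapErr (q x t : ℝ) : ℝ :=
  1 / (1 + q) * ((x + t) ^ (1 + q) - x ^ (1 + q)) - t / 2 * ((x + t) ^ q + x ^ q)

theorem hasDerivAt_shift_rpow {x t : ℝ} (p : ℝ) (h : 0 < x + t) :
    HasDerivAt (fun t => (x + t) ^ p) (p * (x + t) ^ (p - 1)) t := by
  have := ((hasDerivAt_id t).const_add x).rpow_const (p := p) (Or.inl h.ne')
  simpa using this

theorem hasDerivAt_trapErr {q x t : ℝ} (hq : 0 < q) (h : 0 < x + t) :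
    HasDerivAt (trapErr q x)
      (1 / 2 * ((x + t) ^ q - x ^ q) - t / 2 * (q * (x + t) ^ (q - 1))) t := by
  have h1 := ((hasDerivAt_shift_rpow (1 + q) h).sub_const (x ^ (1 + q))).const_mul (1 / (1 + q))
  have h2 := ((hasDerivAt_id t).div_const 2).mul ((hasDerivAt_shift_rpow q h).add_const (x ^ q))
  have h3 := h1.sub h2
  have e : (1 + q - 1) = q := by ring
  rw [e] at h3
  refine h3.congr_deriv ?_
  simp only [id]
  field_simp
  ring

/-- This second derivative in the interval length is nonnegative, decreasing in `x`, and at most its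
value with `x + t` replaced by `x`. Two integrations turn these facts into the sign, the
monotonicity and the size of the error. -/
theorem hasDerivAt_trapErr_deriv {q x t : ℝ} (h : 0 < x + t) :
    HasDerivAt (fun t => 1 / 2 * ((x + t) ^ q - x ^ q) - t / 2 * (q * (x + t) ^ (q - 1)))
      (t / 2 * (q * (1 - q) * (x + t) ^ (q - 2))) t := by
  have h1 := ((hasDerivAt_shift_rpow q h).sub_const (x ^ q)).const_mul (1 / 2)
  have h2 := ((hasDerivAt_id t).div_const 2).mul ((hasDerivAt_shift_rpow (q - 1) h).const_mul q)
  have h3 := h1.sub h2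
  have e : (q - 1 - 1) = q - 2 := by ring
  rw [e] at h3
  refine h3.congr_deriv ?_
  simp only [id]
  ring

theorem trapErr_zero (q x : ℝ) : trapErr q x 0 = 0 := by simp [trapErr]

theorem trapErr_nonneg {q x : ℝ} (hq : 0 < q) (hq1 : q < 1) (hx : 0 < x) : 0 ≤ trapErr q x 1 := by
  refine nonneg_of_second_deriv_nonneg
    (fun t ht => hasDerivAt_trapErr hq (by linarith [ht.1]))
    (fun t ht => hasDerivAt_trapErr_deriv (by linarith [ht.1])) ?_ (trapErr_zero q x).ge (by simp)
  intro t ht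
  have h1 : 0 < x + t := by linarith [ht.1]
  have h2 : 0 < 1 - q := by linarith
  have h3 := ht.1
  positivity

theorem trapErr_anti {q x : ℝ} (hq : 0 < q) (hq1 : q < 1) (hx : 0 < x) :
    trapErr q (x + 1) 1 ≤ trapErr q x 1 := by
  rw [← sub_nonneg]
  refine nonneg_of_second_deriv_nonneg (F := fun t => trapErr q x t - trapErr q (x + 1) t)
    (fun t ht => (hasDerivAt_trapErr hq (by linarith [ht.1])).sub
      (hasDerivAt_trapErr hq (by linarith [ht.1])))
    (fun t ht => (hasDerivAt_trapErr_deriv (by linarith [ht.1])).sub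
      (hasDerivAt_trapErr_deriv (by linarith [ht.1]))) ?_ (by simp [trapErr_zero]) (by simp)
  intro t ht
  have h1 : 0 < x + t := by linarith [ht.1]
  have h2 : 0 < 1 - q := by linarith
  have h3 := ht.1
  have h4 : (x + 1 + t) ^ (q - 2) ≤ (x + t) ^ (q - 2) :=
    Real.rpow_le_rpow_of_nonpos h1 (by linarith) (by linarith)
  have h5 : 0 ≤ t / 2 * (q * (1 - q)) := by positivity
  nlinarith [mul_le_mul_of_nonneg_left h4 h5]

theorem trapErr_le {q x : ℝ} (hq : 0 < q) (hq1 : q < 1) (hx : 0 < x) :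
    trapErr q x 1 ≤ q * (1 - q) * x ^ (q - 2) / 12 := by
  rw [← sub_nonneg]
  have := nonneg_of_second_deriv_nonneg
    (F := fun t => q * (1 - q) * x ^ (q - 2) / 12 * t ^ 3 - trapErr q x t)
    (F' := fun t => q * (1 - q) * x ^ (q - 2) / 4 * t ^ 2 -
      (1 / 2 * ((x + t) ^ q - x ^ q) - t / 2 * (q * (x + t) ^ (q - 1))))
    (F'' := fun t => q * (1 - q) * x ^ (q - 2) / 2 * t -
      (t / 2 * (q * (1 - q) * (x + t) ^ (q - 2))))
    (fun t ht => by
      refine HasDerivAt.sub ?_ (hasDerivAt_trapErr hq (by linarith [ht.1]))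
      refine ((hasDerivAt_pow 3 t).const_mul (q * (1 - q) * x ^ (q - 2) / 12)).congr_deriv ?_
      push_cast; ring)
    (fun t ht => by
      refine HasDerivAt.sub ?_ (hasDerivAt_trapErr_deriv (by linarith [ht.1]))
      refine ((hasDerivAt_pow 2 t).const_mul (q * (1 - q) * x ^ (q - 2) / 4)).congr_deriv ?_
      push_cast; ring) ?_ (by simp [trapErr_zero]) (by simp)
  · simpa using this
  intro t ht
  have h2 : 0 < 1 - q := by linarith
  have h3 := ht.1
  have h4 : (x + t) ^ (q - 2) ≤ x ^ (q - 2) :=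
    Real.rpow_le_rpow_of_nonpos hx (by linarith) (by linarith)
  have h5 : 0 ≤ t / 2 * (q * (1 - q)) := by positivity
  have := mul_le_mul_of_nonneg_left h4 h5
  linarith

/-- By AM–GM the right side is at least `2 (x² - t²)^{p/2}`, and `p ≤ 0`. -/
theorem two_mul_rpow_le {x t p : ℝ} (hp : p ≤ 0) (ht : 0 ≤ t) (htx : t < x) :
    2 * x ^ p ≤ (x + t) ^ p + (x - t) ^ p := by
  have h1 : 0 < x + t := by linarith
  have h2 : 0 < x - t := by linarith
  have hx : 0 < x := by linarith
  have e : (x + t) ^ (p / 2) * (x - t) ^ (p / 2) ≥ x ^ p := by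
    rw [← Real.mul_rpow h1.le h2.le]
    have : x ^ p = (x * x) ^ (p / 2) := by
      rw [Real.mul_rpow hx.le hx.le, ← Real.rpow_add hx]; ring_nf
    rw [this]
    exact Real.rpow_le_rpow_of_nonpos (by positivity) (by nlinarith) (by linarith)
  have s1 : (x + t) ^ p = (x + t) ^ (p / 2) * (x + t) ^ (p / 2) := by
    rw [← Real.rpow_add h1]; ring_nf
  have s2 : (x - t) ^ p = (x - t) ^ (p / 2) * (x - t) ^ (p / 2) := by
    rw [← Real.rpow_add h2]; ring_nf
  rw [s1, s2]
  nlinarith [sq_nonneg ((x + t) ^ (p / 2) - (x - t) ^ (p / 2))]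

theorem second_difference_rpow_ge {q x : ℝ} (hq : 0 < q) (hq1 : q < 1) (hx : 1 < x) :
    q * (1 - q) * x ^ (q - 2) ≤ 2 * x ^ q - (x + 1) ^ q - (x - 1) ^ q := by
  rw [← sub_nonneg]
  have e : q - 1 - 1 = q - 2 := by ring
  have d2 : ∀ p, ∀ t ∈ Set.Icc (0 : ℝ) 1,
      HasDerivAt (fun t => (x - t) ^ p) (-(p * (x - t) ^ (p - 1))) t := by
    intro p t ht
    have := ((hasDerivAt_id t).const_sub x).rpow_const (p := p)
      (Or.inl (by have := ht.2; simp only [id]; linarith))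
    simpa using this
  have := nonneg_of_second_deriv_nonneg
    (F := fun t => 2 * x ^ q - (x + t) ^ q - (x - t) ^ q
      - q * (1 - q) * x ^ (q - 2) * t ^ 2)
    (F' := fun t => q * (x - t) ^ (q - 1) - q * (x + t) ^ (q - 1)
      - q * (1 - q) * x ^ (q - 2) * (2 * t))
    (F'' := fun t => q * (1 - q) * ((x + t) ^ (q - 2) + (x - t) ^ (q - 2) - 2 * x ^ (q - 2)))
    (fun t ht => by
      have h1 : 0 < x + t := by linarith [ht.1]
      refine ((((hasDerivAt_shift_rpow q h1).const_sub (2 * x ^ q)).sub (d2 q t ht)).sub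
        ((hasDerivAt_pow 2 t).const_mul (q * (1 - q) * x ^ (q - 2)))).congr_deriv ?_
      push_cast; ring)
    (fun t ht => by
      have h1 : 0 < x + t := by linarith [ht.1]
      have k1 := hasDerivAt_shift_rpow (q - 1) h1
      have k2 := d2 (q - 1) t ht
      rw [e] at k1 k2
      refine (((k2.const_mul q).sub (k1.const_mul q)).sub
        (((hasDerivAt_id t).const_mul 2).const_mul (q * (1 - q) * x ^ (q - 2)))).congr_deriv ?_
      ring) ?_ (by simp; ring_nf; rfl) (by simp)
  · simpa using this
  intro t ht
  have h2 : 0 < 1 - q := by linarith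
  have := two_mul_rpow_le (x := x) (t := t) (p := q - 2) (by linarith) ht.1 (by linarith [ht.2])
  have : 0 ≤ (x + t) ^ (q - 2) + (x - t) ^ (q - 2) - 2 * x ^ (q - 2) := by linarith
  positivity

theorem first_difference_rpow_ge {q x : ℝ} (hq : 0 < q) (hq1 : q < 1) (hx : 0 ≤ x) :
    q * (x + 1) ^ (q - 1) ≤ (x + 1) ^ q - x ^ q := by
  have h1 : 0 < x + 1 := by linarith
  have h2 : x / (x + 1) = 1 + (-(1 / (x + 1))) := by field_simp; ring
  -- Bernoulli's inequality for an exponent in `[0, 1]`.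
  have h3 : (x / (x + 1)) ^ q ≤ 1 + q * (-(1 / (x + 1))) := by
    rw [h2]
    refine rpow_one_add_le_one_add_mul_self ?_ hq.le hq1.le
    have : 1 / (x + 1) ≤ 1 := by rw [div_le_one h1]; linarith
    linarith
  rw [Real.div_rpow hx h1.le, div_le_iff₀ (by positivity)] at h3
  rw [Real.rpow_sub_one h1.ne']
  have : (1 + q * -(1 / (x + 1))) * (x + 1) ^ q
    = (x + 1) ^ q - q * ((x + 1) ^ q / (x + 1)) := by field_simp; ring
  linarith

/-- The expression vanishes at `p = 0` and `p = 1` and is concave in between. With `p = 1 - α` it is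
`(2 - α)(c_0 + 3 c_1 - 4 c_2)`, for the unmodified formulas of the weights. -/
theorem concave_comb_nonneg {p : ℝ} (hp : 0 ≤ p) (hp1 : p ≤ 1) :
    0 ≤ (-27 / 2 + -9 / 2 * p) + (55 / 2 + 11 / 2 * p) * (2 : ℝ) ^ p
      - (14 + 2 * p) * (3 : ℝ) ^ p := by
  set F : ℝ → ℝ := fun p => (-27 / 2 + -9 / 2 * p) + (55 / 2 + 11 / 2 * p) * (2 : ℝ) ^ p
      - (14 + 2 * p) * (3 : ℝ) ^ p with hF
  have l2 := Real.log_two_gt_d9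
  have l2' := Real.log_two_lt_d9
  have l3 := Real.log_three_gt_d9
  have d : ∀ c : ℝ, 0 < c → ∀ x, HasDerivAt (fun p : ℝ => c ^ p) (c ^ x * Real.log c) x :=
    fun c hc x => Real.hasStrictDerivAt_const_rpow hc x |>.hasDerivAt
  have lin : ∀ u v x : ℝ, HasDerivAt (fun p : ℝ => u + v * p) v x := fun u v x => by
    simpa using ((hasDerivAt_id x).const_mul v).const_add u
  have d1 : ∀ x, HasDerivAt F (-9 / 2 + (11 / 2 * (2 : ℝ) ^ x
      + (55 / 2 + 11 / 2 * x) * ((2 : ℝ) ^ x * Real.log 2))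
      - (2 * (3 : ℝ) ^ x + (14 + 2 * x) * ((3 : ℝ) ^ x * Real.log 3))) x := by
    intro x
    have := ((lin (-27 / 2) (-9 / 2) x).add ((lin (55 / 2) (11 / 2) x).mul (d 2 two_pos x))).sub
      ((lin 14 2 x).mul (d 3 three_pos x))
    refine this.congr_deriv ?_
    ring
  have d2 : ∀ x, HasDerivAt (fun x => (-9 / 2 + (11 / 2 * (2 : ℝ) ^ x
      + (55 / 2 + 11 / 2 * x) * ((2 : ℝ) ^ x * Real.log 2))
      - (2 * (3 : ℝ) ^ x + (14 + 2 * x) * ((3 : ℝ) ^ x * Real.log 3))))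
      ((2 : ℝ) ^ x * (11 * Real.log 2 + (55 / 2 + 11 / 2 * x) * Real.log 2 ^ 2)
      - (3 : ℝ) ^ x * (4 * Real.log 3 + (14 + 2 * x) * Real.log 3 ^ 2)) x := by
    intro x
    have := ((((d 2 two_pos x).const_mul (11 / 2)).add ((lin (55 / 2) (11 / 2) x).mul
      ((d 2 two_pos x).mul_const (Real.log 2)))).const_add (-9 / 2)).sub
      (((d 3 three_pos x).const_mul 2).add ((lin 14 2 x).mul
      ((d 3 three_pos x).mul_const (Real.log 3))))
    refine this.congr_deriv ?_
    ring
  have conc : ConcaveOn ℝ (Set.Icc 0 1) F := by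
    refine concaveOn_of_hasDerivWithinAt2_nonpos (convex_Icc 0 1)
      (fun x _ => (d1 x).continuousAt.continuousWithinAt)
      (fun x _ => (d1 x).hasDerivWithinAt) (fun x _ => (d2 x).hasDerivWithinAt) ?_
    intro x hx
    have hx := interior_subset hx
    obtain ⟨hx0, hx1⟩ := hx
    -- Uses `log (3/2) ≥ 2/5`. The number `21.2` below separates the two brackets of the second
    -- derivative, up to this factor `1 + 2x/5`.
    have h32 : (2 : ℝ) ^ x * (1 + 2 / 5 * x) ≤ (3 : ℝ) ^ x := by
      have e1 : (3 : ℝ) ^ x = (2 : ℝ) ^ x * Real.exp ((Real.log 3 - Real.log 2) * x) := by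
        rw [Real.rpow_def_of_pos two_pos, Real.rpow_def_of_pos three_pos, ← Real.exp_add]
        ring_nf
      rw [e1]
      have := Real.add_one_le_exp ((Real.log 3 - Real.log 2) * x)
      gcongr
      nlinarith
    have hpos : 0 < (2 : ℝ) ^ x := by positivity
    have h3 : 21.2 ≤ 4 * Real.log 3 + (14 + 2 * x) * Real.log 3 ^ 2 := by
      have : 1.2 ≤ Real.log 3 ^ 2 := by nlinarith
      nlinarith
    have h2 : 11 * Real.log 2 + (55 / 2 + 11 / 2 * x) * Real.log 2 ^ 2 ≤ 21.2 * (1 + 2 / 5 * x) := by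
      have : Real.log 2 ^ 2 ≤ 0.481 := by nlinarith
      nlinarith
    have k1 := mul_le_mul_of_nonneg_left h2 hpos.le
    have k2 : (2 : ℝ) ^ x * (1 + 2 / 5 * x) * 21.2
        ≤ (3 : ℝ) ^ x * (4 * Real.log 3 + (14 + 2 * x) * Real.log 3 ^ 2) := by gcongr
    linarith
  have := conc.2 (Set.left_mem_Icc.2 zero_le_one) (Set.right_mem_Icc.2 zero_le_one)
    (sub_nonneg.2 hp1) hp (by ring)
  have f0 : F 0 = 0 := by simp [hF]; norm_num
  have f1 : F 1 = 0 := by simp [hF]; norm_num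
  rw [f0, f1] at this
  simpa [hF] using this

/-! ### Estimates for the coefficients `a` and `b`. -/

theorem b_eq_trapErr (α : ℝ) (s : ℕ) : b α s = trapErr (1 - α) s 1 := by
  have e : 1 + (1 - α) = 2 - α := by ring
  simp only [b, trapErr, e]

theorem b_nonneg {α : ℝ} (hα : 0 < α) (hα' : α < 1) {s : ℕ} (hs : 1 ≤ s) : 0 ≤ b α s := by
  rw [b_eq_trapErr]
  exact trapErr_nonneg (by linarith) (by linarith) (by exact_mod_cast hs)

theorem b_succ_le {α : ℝ} (hα : 0 < α) (hα' : α < 1) {s : ℕ} (hs : 1 ≤ s) :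
    b α (s + 1) ≤ b α s := by
  rw [b_eq_trapErr, b_eq_trapErr]
  push_cast
  exact trapErr_anti (by linarith) (by linarith) (by exact_mod_cast hs)

theorem b_le {α : ℝ} (hα : 0 < α) (hα' : α < 1) {s : ℕ} (hs : 1 ≤ s) :
    b α s ≤ (1 - α) * α * (s : ℝ) ^ (-1 - α) / 12 := by
  rw [b_eq_trapErr]
  have := trapErr_le (q := 1 - α) (x := s) (by linarith) (by linarith) (by exact_mod_cast hs)
  rwa [show 1 - (1 - α) = α by ring, show 1 - α - 2 = -1 - α by ring] at this

theorem b_zero (α : ℝ) (hα : 0 < α) (hα' : α < 1) : b α 0 = 1 / (2 - α) - 1 / 2 := by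
  have h1 : 2 - α ≠ 0 := by linarith
  have h2 : 1 - α ≠ 0 := by linarith
  simp [b, Real.zero_rpow h1, Real.zero_rpow h2]

theorem a_zero {α : ℝ} (hα' : α < 1) : a α 0 = 1 := by
  have h2 : 1 - α ≠ 0 := by linarith
  simp [a, Real.zero_rpow h2]

theorem a_ge {α : ℝ} (hα : 0 < α) (hα' : α < 1) (s : ℕ) :
    (1 - α) * ((s : ℝ) + 1) ^ (-α) ≤ a α s := by
  have := first_difference_rpow_ge (q := 1 - α) (x := s) (by linarith) (by linarith)
    (Nat.cast_nonneg s)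
  rwa [show 1 - α - 1 = -α by ring] at this

theorem a_nonneg {α : ℝ} (hα : 0 < α) (hα' : α < 1) (s : ℕ) : 0 ≤ a α s := by
  refine le_trans ?_ (a_ge hα hα' s)
  have : 0 < 1 - α := by linarith
  positivity

theorem a_sub_a_succ_ge {α : ℝ} (hα : 0 < α) (hα' : α < 1) {s : ℕ} (hs : 1 ≤ s) :
    (1 - α) * α * ((s : ℝ) + 1) ^ (-1 - α) ≤ a α s - a α (s + 1) := by
  have hs' : (1 : ℝ) ≤ s := by exact_mod_cast hs
  have := second_difference_rpow_ge (q := 1 - α) (x := (s : ℝ) + 1) (by linarith) (by linarith)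
    (by linarith)
  rw [show 1 - (1 - α) = α by ring, show 1 - α - 2 = -1 - α by ring] at this
  refine this.trans (le_of_eq ?_)
  simp only [a]
  push_cast
  ring_nf

theorem sum_range_a (α : ℝ) (hα' : α < 1) (n : ℕ) :
    ∑ s ∈ range n, a α s = (n : ℝ) ^ (1 - α) := by
  induction n with
  | zero =>
    have h2 : 1 - α ≠ 0 := by linarith
    simp [Real.zero_rpow h2]
  | succ n ih => rw [sum_range_succ, ih, a]; push_cast; ring

/-- Since `s + 2 ≤ 3 s`, the loss is at most `3^{1+α} ≤ 9`. This stays below the `12` in `b_le`, so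
`b` is dominated by shifted differences of `a`. -/
theorem rpow_pred_le {α : ℝ} (hα : 0 < α) (hα' : α < 1) {s : ℕ} (hs : 1 ≤ s) :
    (s : ℝ) ^ (-1 - α) ≤ 9 * ((s : ℝ) + 2) ^ (-1 - α) := by
  have hs' : (1 : ℝ) ≤ s := by exact_mod_cast hs
  have h1 : (s : ℝ) ^ (-1 - α) ≤ (((s : ℝ) + 2) / 3) ^ (-1 - α) :=
    Real.rpow_le_rpow_of_nonpos (by positivity) (by linarith) (by linarith)
  rw [Real.div_rpow (by positivity) (by norm_num), div_eq_mul_inv, ← Real.rpow_neg (by norm_num)]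
    at h1
  have h2 : (3 : ℝ) ^ (-(-1 - α)) ≤ (3 : ℝ) ^ (2 : ℝ) :=
    Real.rpow_le_rpow_of_exponent_le (by norm_num) (by linarith)
  have h3 : (3 : ℝ) ^ (2 : ℝ) = 9 := by norm_num
  rw [h3] at h2
  have h4 : 0 ≤ ((s : ℝ) + 2) ^ (-1 - α) := by positivity
  nlinarith

theorem b_le_a_sub_a {α : ℝ} (hα : 0 < α) (hα' : α < 1) {s : ℕ} (hs : 1 ≤ s) :
    b α s ≤ a α (s + 1) - a α (s + 2) := by
  have h1 := b_le hα hα' hs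
  have h2 := rpow_pred_le hα hα' hs
  have h3 := a_sub_a_succ_ge hα hα' (s := s + 1) (by omega)
  push_cast at h3
  rw [show (s : ℝ) + 1 + 1 = s + 2 by ring] at h3
  have h4 : 0 ≤ ((s : ℝ) + 2) ^ (-1 - α) := by positivity
  have h5 : 0 < (1 - α) * α := mul_pos (by linarith) hα
  have h6 := mul_le_mul_of_nonneg_left h2 h5.le
  have h7 := mul_nonneg h5.le h4
  linarith

theorem b_le_rpow_succ {α : ℝ} (hα : 0 < α) (hα' : α < 1) {s : ℕ} (hs : 1 ≤ s) :
    b α s ≤ (1 - α) / 4 * ((s : ℝ) + 2) ^ (-α) := by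
  have hs' : (1 : ℝ) ≤ s := by exact_mod_cast hs
  have h1 := b_le hα hα' hs
  have h2 := rpow_pred_le hα hα' hs
  have hp : 0 < (s : ℝ) + 2 := by linarith
  have h5 : 0 < (1 - α) * α := mul_pos (by linarith) hα
  have h6 := mul_le_mul_of_nonneg_left h2 h5.le
  have h3 : ((s : ℝ) + 2) ^ (-1 - α) ≤ ((s : ℝ) + 2) ^ (-α) / 3 := by
    rw [show -1 - α = -α - 1 by ring, Real.rpow_sub_one hp.ne']
    gcongr
    linarith
  have h7 := mul_le_mul_of_nonneg_left h3 h5.le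
  have h8 : 0 ≤ (1 - α) * ((s : ℝ) + 2) ^ (-α) := mul_nonneg (by linarith) (by positivity)
  nlinarith

theorem b_le_quarter_a {α : ℝ} (hα : 0 < α) (hα' : α < 1) {s : ℕ} (hs : 1 ≤ s) :
    b α s ≤ a α (s + 1) / 4 := by
  have h1 := b_le_rpow_succ hα hα' hs
  have h2 := a_ge hα hα' (s + 1)
  push_cast at h2
  rw [show (s : ℝ) + 1 + 1 = s + 2 by ring] at h2
  linarith

theorem c_zero_add_three_c_one {α : ℝ} (hα : 0 < α) (hα' : α < 1) :
    4 * (a α 2 + b α 2 - b α 1) ≤ (a α 0 + b α 0) + 3 * (a α 1 + b α 1 - b α 0) := by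
  have h := concave_comb_nonneg (p := 1 - α) (by linarith) (by linarith)
  have e : ∀ x : ℝ, 0 < x → x ^ (2 - α) = x * x ^ (1 - α) := by
    intro x hx
    rw [show 2 - α = (1 - α) + 1 by ring, Real.rpow_add_one hx.ne', mul_comm]
  have hp : 0 < 2 - α := by linarith
  have e2 := e 2 two_pos
  have e3 := e 3 three_pos
  rw [a_zero hα', b_zero α hα hα', ← sub_nonneg]
  simp only [a, b]
  push_cast
  rw [show (1 : ℝ) + 1 = 2 by norm_num, show (2 : ℝ) + 1 = 3 by norm_num, e2, e3,
    Real.one_rpow, Real.one_rpow]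
  generalize (2 : ℝ) ^ (1 - α) = X at *
  generalize (3 : ℝ) ^ (1 - α) = Y at *
  have := div_nonneg h hp.le
  refine this.trans (le_of_eq ?_)
  field_simp
  ring

/-- The gap is `1 - a 1 + 2 b 0 - b 1`, where `a 1 ≤ 1`, `b 0 ≥ α/4` and `b 1 ≤ α(1 - α)/12`. -/
theorem c_one_le_c_zero {α : ℝ} (hα : 0 < α) (hα' : α < 1) :
    a α 1 + b α 1 - b α 0 ≤ a α 0 + b α 0 := by
  have h0 := b_zero α hα hα'
  have h1 := b_le hα hα' (s := 1) le_rfl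
  have h2 : a α 1 ≤ 1 := by
    have : (2 : ℝ) ^ (1 - α) ≤ 2 ^ (1 : ℝ) :=
      Real.rpow_le_rpow_of_exponent_le (by norm_num) (by linarith)
    simp only [a]
    push_cast
    rw [Real.rpow_one] at this
    rw [Real.one_rpow, show (1 : ℝ) + 1 = 2 by norm_num]
    linarith
  rw [a_zero hα']
  have h3 : α / 4 ≤ b α 0 := by
    rw [h0, div_sub_div _ _ (by linarith) (by norm_num), div_le_div_iff₀ (by norm_num) (by linarith)]
    nlinarith
  simp only [Nat.cast_one, Real.one_rpow] at h1
  nlinarith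

theorem b_zero_nonneg {α : ℝ} (hα : 0 < α) (hα' : α < 1) : 0 ≤ b α 0 := by
  rw [b_zero α hα hα', sub_nonneg]
  exact one_div_le_one_div_of_le (by linarith) (by linarith)

/-! ### Splitting off the backward difference; monotone weights. -/

/-- The common value of the two leading weights that remain after splitting off the
backward difference part. -/
def leadWeight (α : ℝ) : ℝ := ((a α 0 + b α 0) + 3 * (a α 1 + b α 1 - b α 0)) / 4

/-- The weight of the two-step backward difference part. -/
def bdfWeight (α : ℝ) : ℝ := ((a α 0 + b α 0) - (a α 1 + b α 1 - b α 0)) / 4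

/-- The weights, independent of the time level, after the backward difference part has been
split off. -/
def kern (α : ℝ) (s : ℕ) : ℝ := if s ≤ 1 then leadWeight α else a α s + b α s - b α (s - 1)

/-- The weights at time level `j + 1` after the backward difference part has been split off. -/
def levelKern (α : ℝ) (j s : ℕ) : ℝ :=
  kern α s + (if s = j - 1 then b α j else 0) - if s = j then 2 * b α j else 0

theorem bdfWeight_nonneg {α : ℝ} (hα : 0 < α) (hα' : α < 1) : 0 ≤ bdfWeight α := by
  have := c_one_le_c_zero hα hα'
  unfold bdfWeight
  linarith

theorem kern_of_two_le (α : ℝ) {s : ℕ} (hs : 2 ≤ s) : kern α s = a α s + b α s - b α (s - 1) :=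
  if_neg (by omega)

/-- The margin `b (s + 2)` is needed at `s = j - 2`: the next weight of level `j` carries the extra
summand `b j`. -/
theorem kern_sub_kern_succ_ge {α : ℝ} (hα : 0 < α) (hα' : α < 1) {s : ℕ} (hs : 2 ≤ s) :
    b α (s + 2) ≤ kern α s - kern α (s + 1) := by
  obtain ⟨s, rfl⟩ : ∃ t, s = t + 1 := ⟨s - 1, by omega⟩
  rw [kern_of_two_le α hs, kern_of_two_le α (by omega)]
  simp only [Nat.add_sub_cancel]
  have h1 := b_le_a_sub_a hα hα' (s := s) (by omega)
  have h2 := b_succ_le hα hα' (s := s + 1) (by omega)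
  have h3 := b_succ_le hα hα' (s := s + 1 + 1) (by omega)
  have h4 := b_nonneg hα hα' (s := s + 1 + 1) (by omega)
  have h5 := b_succ_le hα hα' (s := s) (by omega)
  rw [show s + 1 + 1 = s + 2 by ring] at *
  rw [show s + 1 + 2 = s + 2 + 1 by ring]
  linarith

theorem kern_succ_le {α : ℝ} (hα : 0 < α) (hα' : α < 1) (s : ℕ) :
    kern α (s + 1) ≤ kern α s := by
  rcases Nat.lt_or_ge s 2 with h | h
  · interval_cases s
    · simp [kern]
    · have := c_zero_add_three_c_one hα hα'
      simp only [kern, leadWeight]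
      norm_num
      linarith
  · have := kern_sub_kern_succ_ge hα hα' h
    have := b_nonneg hα hα' (s := s + 2) (by omega)
    linarith

/-- The summand `2 b s` pays for the correction of the oldest weight, which is `kern j - 2 b j`; the
power is the coercivity that remains. -/
theorem kern_sub_ge {α : ℝ} (hα : 0 < α) (hα' : α < 1) {s : ℕ} (hs : 2 ≤ s) :
    (1 - α) / 2 * ((s : ℝ) + 1) ^ (-α) + 2 * b α s ≤ kern α s := by
  obtain ⟨s, rfl⟩ : ∃ t, s = t + 1 := ⟨s - 1, by omega⟩
  rw [kern_of_two_le α hs]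
  simp only [Nat.add_sub_cancel]
  have h1 := b_le_rpow_succ hα hα' (s := s) (by omega)
  have h2 := b_succ_le hα hα' (s := s) (by omega)
  have h3 := a_ge hα hα' (s + 1)
  push_cast at h3 ⊢
  rw [show (s : ℝ) + 1 + 1 = s + 2 by ring] at *
  linarith

theorem kern_antitone {α : ℝ} (hα : 0 < α) (hα' : α < 1) : Antitone (kern α) :=
  antitone_nat_of_succ_le (kern_succ_le hα hα')

theorem kern_ge {α : ℝ} (hα : 0 < α) (hα' : α < 1) {s n : ℕ} (hn : 3 ≤ n) (hs : s < n) :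
    (1 - α) / 2 * (n : ℝ) ^ (-α) ≤ kern α s := by
  obtain ⟨n, rfl⟩ : ∃ t, n = t + 1 := ⟨n - 1, by omega⟩
  refine le_trans ?_ (kern_antitone hα hα' (show s ≤ n by omega))
  have := kern_sub_ge hα hα' (s := n) (by omega)
  have := b_nonneg hα hα' (s := n) (by omega)
  push_cast
  linarith

theorem kern_nonneg {α : ℝ} (hα : 0 < α) (hα' : α < 1) (s : ℕ) : 0 ≤ kern α s := by
  refine le_trans ?_ (kern_ge hα hα' (n := s + 3) (by omega) (by omega))
  have : 0 < 1 - α := by linarith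
  positivity

theorem kern_le_a {α : ℝ} (hα : 0 < α) (hα' : α < 1) {s : ℕ} (hs : 2 ≤ s) :
    kern α s ≤ a α s := by
  obtain ⟨s, rfl⟩ : ∃ t, s = t + 1 := ⟨s - 1, by omega⟩
  rw [kern_of_two_le α hs]
  simp only [Nat.add_sub_cancel]
  have := b_succ_le hα hα' (s := s) (by omega)
  linarith

theorem b_le_a {α : ℝ} (hα : 0 < α) (hα' : α < 1) {s : ℕ} (hs : 2 ≤ s) : b α s ≤ a α s := by
  obtain ⟨s, rfl⟩ : ∃ t, s = t + 1 := ⟨s - 1, by omega⟩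
  have h1 := b_le_quarter_a hα hα' (s := s) (by omega)
  have h2 := b_succ_le hα hα' (s := s) (by omega)
  have h3 := a_nonneg hα hα' (s + 1)
  linarith

theorem levelKern_succ_le {α : ℝ} (hα : 0 < α) (hα' : α < 1) {j s : ℕ} (hj : 4 ≤ j) (hs : s < j) :
    levelKern α j (s + 1) ≤ levelKern α j s := by
  have h1 := kern_succ_le hα hα' s
  have hb := b_nonneg hα hα' (s := j) (by omega)
  unfold levelKern
  rw [if_neg (show ¬ s = j by omega)]
  rcases Nat.lt_or_ge (s + 1) (j - 1) with h | h
  · rw [if_neg (by omega), if_neg (by omega), if_neg (by omega)]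
    linarith
  rcases Nat.eq_or_lt_of_le h with h | h
  · rw [if_pos (by omega), if_neg (by omega), if_neg (by omega)]
    -- Here `s = j - 2`, and `j ≥ 4` ensures `s ≥ 2`.
    have := kern_sub_kern_succ_ge hα hα' (s := s) (by omega)
    rw [show s + 2 = j by omega] at this
    linarith
  · rw [if_neg (by omega), if_pos (by omega), if_pos (by omega)]
    linarith

theorem levelKern_self_nonneg {α : ℝ} (hα : 0 < α) (hα' : α < 1) {j : ℕ} (hj : 4 ≤ j) :
    0 ≤ levelKern α j j := by
  unfold levelKern
  rw [if_neg (by omega), if_pos rfl]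
  have := kern_sub_ge hα hα' (s := j) (by omega)
  have : 0 ≤ (1 - α) / 2 * ((j : ℝ) + 1) ^ (-α) :=
    mul_nonneg (by linarith) (by positivity)
  linarith

theorem c_eq_levelKern {α : ℝ} {j s : ℕ} (hj : 4 ≤ j) :
    c α j s = levelKern α j s + (if s = 0 then 3 * bdfWeight α else 0)
      - if s = 1 then bdfWeight α else 0 := by
  unfold c levelKern
  rw [if_neg (by omega)]
  rcases Nat.lt_or_ge s 2 with h | h
  · interval_cases s
    · rw [if_pos rfl, if_pos rfl, if_neg (by omega), if_neg (by omega), if_neg (by omega)]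
      simp only [kern, leadWeight, bdfWeight]
      norm_num; ring
    · rw [if_neg (by omega), if_neg (by omega), if_neg (by omega), if_neg (by omega),
        if_neg (by omega), if_neg (by omega), if_pos rfl]
      simp only [kern, leadWeight, bdfWeight]
      norm_num; ring
  · rw [kern_of_two_le α h, if_neg (show ¬ s = 0 by omega), if_neg (show ¬ s = 0 by omega),
      if_neg (show ¬ s = 1 by omega)]
    by_cases h1 : s = j
    · subst h1
      rw [if_pos rfl, if_neg (by omega), if_pos rfl]
      ring
    · rw [if_neg h1, if_neg h1]
      by_cases h2 : s = j - 1
      · subst h2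
        rw [if_pos rfl, if_pos rfl, show j - 1 - 1 = j - 2 by omega]
        ring
      · rw [if_neg h2, if_neg h2]
        ring

/-! ### Lower bounds for the quadratic form in time. -/

theorem sum_mul_sub_ge {w D : ℕ → ℝ} (hD : ∀ s, 0 ≤ D s) {n : ℕ} (h0 : 0 ≤ w 0)
    (hw : ∀ s < n, w s ≤ w (s + 1)) :
    -(w n * D (n + 1)) ≤ ∑ s ∈ range (n + 1), w s * (D s - D (s + 1)) := by
  induction n with
  | zero =>
    have := mul_nonneg h0 (hD 0)
    simp only [zero_add, range_one, sum_singleton]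
    linarith
  | succ n ih =>
    rw [sum_range_succ]
    have := ih fun s hs => hw s (by omega)
    have := mul_le_mul_of_nonneg_right (hw n (by omega)) (hD (n + 1))
    linarith

/-- Polarization leaves the weighted increments of `D s = (y (n+1) - y s)²`. Their sum is
nonnegative by Abel summation, because `D (n+1) = 0`. The weights increase with `s` as they are
indexed by time, not by age. -/
theorem mul_sum_weights_ge {w y : ℕ → ℝ} {n : ℕ} (h0 : 0 ≤ w 0)
    (hw : ∀ s < n, w s ≤ w (s + 1)) :
    1 / 2 * ∑ s ∈ range (n + 1), w s * (y (s + 1) ^ 2 - y s ^ 2)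
      ≤ y (n + 1) * ∑ s ∈ range (n + 1), w s * (y (s + 1) - y s) := by
  have h := sum_mul_sub_ge (D := fun s => (y (n + 1) - y s) ^ 2) (fun s => sq_nonneg _) h0 hw
  have e : y (n + 1) * ∑ s ∈ range (n + 1), w s * (y (s + 1) - y s)
      = 1 / 2 * ∑ s ∈ range (n + 1), w s * (y (s + 1) ^ 2 - y s ^ 2)
        + 1 / 2 * ∑ s ∈ range (n + 1),
          w s * ((y (n + 1) - y s) ^ 2 - (y (n + 1) - y (s + 1)) ^ 2) := by
    rw [mul_sum, mul_sum, mul_sum, ← sum_add_distrib]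
    exact sum_congr rfl fun s _ => by ring
  simp only [sub_self] at h
  rw [e]
  have : 0 ≤ w n := by
    clear h e
    induction n with
    | zero => exact h0
    | succ n ih => exact (ih fun s hs => hw s (by omega)).trans (hw n (by omega))
  nlinarith

theorem sum_levelKern (α : ℝ) (z : ℕ → ℝ) {j : ℕ} (hj : 1 ≤ j) :
    ∑ s ∈ range (j + 1), levelKern α j (j - s) * (z (s + 1) - z s)
      = ∑ s ∈ range (j + 1), kern α (j - s) * (z (s + 1) - z s)
        + b α j * (z 2 - z 1) - 2 * b α j * (z 1 - z 0) := by
  have h1 : ∑ s ∈ range (j + 1), (if s = 1 then b α j * (z 2 - z 1) else 0)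
      = b α j * (z 2 - z 1) := by
    rw [sum_ite_eq' (range (j + 1)) 1, if_pos (mem_range.2 (by omega))]
  have h0 : ∑ s ∈ range (j + 1), (if s = 0 then 2 * b α j * (z 1 - z 0) else 0)
      = 2 * b α j * (z 1 - z 0) := by
    rw [sum_ite_eq' (range (j + 1)) 0, if_pos (mem_range.2 (by omega))]
  rw [← h1, ← h0, ← sum_add_distrib, ← sum_sub_distrib]
  refine sum_congr rfl fun s hs => ?_
  have hs := mem_range.1 hs
  unfold levelKern
  by_cases k0 : s = 0
  · subst k0
    rw [if_neg (by omega), if_pos (by omega), if_neg (by omega), if_pos rfl]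
    ring
  · rw [if_neg (show ¬ j - s = j by omega), if_neg k0]
    by_cases k1 : s = 1
    · subst k1
      rw [if_pos rfl, if_pos rfl]
      ring
    · rw [if_neg (show ¬ j - s = j - 1 by omega), if_neg k1]
      ring

theorem sum_c_eq (α : ℝ) (y : ℕ → ℝ) {j : ℕ} (hj : 4 ≤ j) :
    ∑ s ∈ range (j + 1), c α j (j - s) * (y (s + 1) - y s)
      = ∑ s ∈ range (j + 1), levelKern α j (j - s) * (y (s + 1) - y s)
        + bdfWeight α * (3 * (y (j + 1) - y j) - (y j - y (j - 1))) := by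
  have h1 : ∑ s ∈ range (j + 1), (if s = j - 1 then bdfWeight α * (y j - y (j - 1)) else 0)
      = bdfWeight α * (y j - y (j - 1)) := by
    rw [sum_ite_eq' (range (j + 1)) (j - 1), if_pos (mem_range.2 (by omega))]
  have h0 : ∑ s ∈ range (j + 1), (if s = j then 3 * bdfWeight α * (y (j + 1) - y j) else 0)
      = 3 * bdfWeight α * (y (j + 1) - y j) := by
    rw [sum_ite_eq' (range (j + 1)) j, if_pos (mem_range.2 (by omega))]
  have e : bdfWeight α * (3 * (y (j + 1) - y j) - (y j - y (j - 1)))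
      = 3 * bdfWeight α * (y (j + 1) - y j) - bdfWeight α * (y j - y (j - 1)) := by ring
  rw [e, ← h1, ← h0, ← sum_sub_distrib, ← sum_add_distrib]
  refine sum_congr rfl fun s hs => ?_
  have hs := mem_range.1 hs
  rw [c_eq_levelKern hj]
  by_cases k0 : s = j
  · rw [if_pos (by omega), if_neg (by omega), if_pos k0, if_neg (by omega), k0]
    ring
  · rw [if_neg (show ¬ j - s = 0 by omega), if_neg k0]
    by_cases k1 : s = j - 1
    · rw [if_pos (by omega), if_pos k1, k1, Nat.sub_add_cancel (by omega)]
      ring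
    · rw [if_neg (show ¬ j - s = 1 by omega), if_neg k1]
      ring

/-- The quadratic form `y^{j+1} ∑_s c^{(j)}_{j-s} (y^{s+1} - y^s)`. -/
def timeForm (α : ℝ) (y : ℕ → ℝ) (j : ℕ) : ℝ :=
  y (j + 1) * ∑ s ∈ range (j + 1), c α j (j - s) * (y (s + 1) - y s)

theorem two_mul_timeForm_ge {α : ℝ} (hα : 0 < α) (hα' : α < 1) (y : ℕ → ℝ) {j : ℕ} (hj : 4 ≤ j) :
    ∑ s ∈ range (j + 1), kern α (j - s) * (y (s + 1) ^ 2 - y s ^ 2)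
        - 3 * b α j * y 1 ^ 2
        + bdfWeight α * ((y (j + 1) ^ 2 + (2 * y (j + 1) - y j) ^ 2)
          - (y j ^ 2 + (2 * y j - y (j - 1)) ^ 2))
      ≤ 2 * timeForm α y j := by
  have h1 := mul_sum_weights_ge (w := fun s => levelKern α j (j - s)) (y := y) (n := j)
    (by simpa using levelKern_self_nonneg hα hα' hj)
    (fun s hs => by
      have := levelKern_succ_le hα hα' hj (s := j - (s + 1)) (by omega)
      rwa [show j - (s + 1) + 1 = j - s by omega] at this)
  have h2 := sum_levelKern α (fun s => y s ^ 2) (j := j) (by omega)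
  rw [h2] at h1
  have hb := b_nonneg hα hα' (s := j) (by omega)
  have hθ := bdfWeight_nonneg hα hα'
  rw [timeForm, sum_c_eq α y hj, mul_add]
  have h3 := mul_nonneg hθ (sq_nonneg (y (j + 1) - 2 * y j + y (j - 1)))
  have h4 := mul_nonneg hb (sq_nonneg (y 2))
  have h5 := mul_nonneg hb (sq_nonneg (y 0))
  -- The G-stability identity of the two-step backward difference formula.
  have e : 2 * (y (j + 1) * (bdfWeight α * (3 * (y (j + 1) - y j) - (y j - y (j - 1)))))
    = bdfWeight α * ((y (j + 1) ^ 2 + (2 * y (j + 1) - y j) ^ 2)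
          - (y j ^ 2 + (2 * y j - y (j - 1)) ^ 2))
      + bdfWeight α * (y (j + 1) - 2 * y j + y (j - 1)) ^ 2 := by ring
  linarith

theorem sum_timeForm_ge_aux {α : ℝ} (hα : 0 < α) (hα' : α < 1) (y : ℕ → ℝ) {n : ℕ} (hn : 4 ≤ n) :
    ∑ s ∈ range n, kern α (n - 1 - s) * y (s + 1) ^ 2
        - ∑ s ∈ range 4, kern α (3 - s) * y (s + 1) ^ 2
        - y 0 ^ 2 * ∑ j ∈ Ico 4 n, a α j - 3 * y 1 ^ 2 * ∑ j ∈ Ico 4 n, a α j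
        + bdfWeight α * ((y n ^ 2 + (2 * y n - y (n - 1)) ^ 2)
          - (y 4 ^ 2 + (2 * y 4 - y 3) ^ 2))
      ≤ 2 * ∑ j ∈ Ico 4 n, timeForm α y j := by
  induction n, hn using Nat.le_induction with
  | base => simp
  | succ n hn ih =>
    rw [sum_Ico_succ_top hn, sum_Ico_succ_top hn]
    have h := two_mul_timeForm_ge hα hα' y hn
    have h1 := mul_le_mul_of_nonneg_right (kern_le_a hα hα' (s := n) (by omega))
      (sq_nonneg (y 0))
    have h2 := mul_le_mul_of_nonneg_right (b_le_a hα hα' (s := n) (by omega))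
      (sq_nonneg (y 1))
    -- As `kern` does not depend on the level, this is the difference of two consecutive discrete
    -- convolutions, up to the contribution of `y 0`.
    have e : ∑ s ∈ range (n + 1), kern α (n - s) * (y (s + 1) ^ 2 - y s ^ 2)
        = ∑ s ∈ range (n + 1), kern α (n - s) * y (s + 1) ^ 2
          - (∑ s ∈ range n, kern α (n - 1 - s) * y (s + 1) ^ 2 + kern α n * y 0 ^ 2) := by
      simp only [mul_sub]
      rw [sum_sub_distrib, sum_range_succ' (fun s => kern α (n - s) * y s ^ 2)]
      simp only [Nat.sub_zero, Nat.sub_sub, Nat.add_comm 1]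
    rw [e] at h
    simp only [Nat.add_sub_cancel]
    linarith

theorem sum_timeForm_ge {α : ℝ} (hα : 0 < α) (hα' : α < 1) (y : ℕ → ℝ) {n : ℕ} (hn : 4 ≤ n) :
    (1 - α) / 4 * (n : ℝ) ^ (-α) * ∑ j ∈ Ico 4 n, y (j + 1) ^ 2
        - (leadWeight α + 9 * bdfWeight α) * (y 1 ^ 2 + y 2 ^ 2 + y 3 ^ 2 + y 4 ^ 2)
        - 3 * (n : ℝ) ^ (1 - α) * (y 0 ^ 2 + y 1 ^ 2)
      ≤ ∑ j ∈ Ico 4 n, timeForm α y j := by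
  have h := sum_timeForm_ge_aux hα hα' y hn
  have hq : 0 ≤ (1 - α) / 2 * (n : ℝ) ^ (-α) := mul_nonneg (by linarith) (by positivity)
  have h1 : (1 - α) / 2 * (n : ℝ) ^ (-α) * ∑ j ∈ Ico 4 n, y (j + 1) ^ 2
      ≤ ∑ s ∈ range n, kern α (n - 1 - s) * y (s + 1) ^ 2 := by
    rw [mul_sum]
    refine (sum_le_sum_of_subset_of_nonneg (t := range n)
      (fun j hj => mem_range.2 (mem_Ico.1 hj).2) fun i _ _ => mul_nonneg hq (sq_nonneg _)).trans ?_
    refine sum_le_sum fun s hs => mul_le_mul_of_nonneg_right ?_ (sq_nonneg _)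
    have := mem_range.1 hs
    exact kern_ge hα hα' (by omega) (by omega)
  have h2 : ∑ s ∈ range 4, kern α (3 - s) * y (s + 1) ^ 2
      ≤ leadWeight α * (y 1 ^ 2 + y 2 ^ 2 + y 3 ^ 2 + y 4 ^ 2) := by
    have k : ∀ s, kern α s ≤ leadWeight α := fun s => kern_antitone hα hα' (Nat.zero_le s)
    have : ∑ s ∈ range 4, kern α (3 - s) * y (s + 1) ^ 2
        ≤ ∑ s ∈ range 4, leadWeight α * y (s + 1) ^ 2 :=
      sum_le_sum fun s _ => mul_le_mul_of_nonneg_right (k _) (sq_nonneg _)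
    refine this.trans (le_of_eq ?_)
    simp only [sum_range_succ, range_zero, sum_empty]
    ring
  have h3 : ∑ j ∈ Ico 4 n, a α j ≤ (n : ℝ) ^ (1 - α) := by
    rw [← sum_range_a α hα' n]
    exact sum_le_sum_of_subset_of_nonneg (fun j hj => mem_range.2 (mem_Ico.1 hj).2)
      fun i _ _ => a_nonneg hα hα' i
  have h4 := mul_le_mul_of_nonneg_left h3 (sq_nonneg (y 0))
  have h5 := mul_le_mul_of_nonneg_left h3 (sq_nonneg (y 1))
  have hθ := bdfWeight_nonneg hα hα'
  have h6 : 0 ≤ bdfWeight α * (y n ^ 2 + (2 * y n - y (n - 1)) ^ 2) := by positivity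
  have h7 : bdfWeight α * (y 4 ^ 2 + (2 * y 4 - y 3) ^ 2)
      ≤ bdfWeight α * (9 * (y 1 ^ 2 + y 2 ^ 2 + y 3 ^ 2 + y 4 ^ 2)) := by
    refine mul_le_mul_of_nonneg_left ?_ hθ
    nlinarith [sq_nonneg (2 * y 4 + y 3), sq_nonneg (y 1), sq_nonneg (y 2), sq_nonneg (y 3)]
  have h8 : 0 ≤ leadWeight α := by simpa [kern] using kern_nonneg hα hα' 0
  have h9 : 0 ≤ (leadWeight α + 9 * bdfWeight α) * (y 1 ^ 2 + y 2 ^ 2 + y 3 ^ 2 + y 4 ^ 2) := by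
    positivity
  have h10 : 0 ≤ (n : ℝ) ^ (1 - α) * y 0 ^ 2 := by positivity
  have h11 : 0 ≤ (n : ℝ) ^ (1 - α) * y 1 ^ 2 := by positivity
  linarith

theorem one_le_c_zero {α : ℝ} (hα : 0 < α) (hα' : α < 1) (j : ℕ) : 1 ≤ c α j 0 := by
  have h0 := b_zero_nonneg hα hα'
  have h1 := b_nonneg hα hα' (s := 1) le_rfl
  have h2 := a_zero hα'
  unfold c
  split_ifs <;> first | linarith | contradiction

theorem exists_sum_mul_sub_eq (d : ℕ → ℝ) (n : ℕ) : ∃ l : ℕ → ℝ, ∀ y : ℕ → ℝ,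
    ∑ s ∈ range (n + 1), d s * (y (s + 1) - y s)
      = d n * y (n + 1) + ∑ s ∈ range (n + 1), l s * y s := by
  induction n with
  | zero => exact ⟨fun _ => -d 0, fun y => by simp; ring⟩
  | succ n ih =>
    obtain ⟨l, hl⟩ := ih
    refine ⟨Function.update l (n + 1) (d n - d (n + 1)), fun y => ?_⟩
    rw [sum_range_succ, hl, sum_range_succ (fun s => Function.update l _ _ s * y s) (n + 1)]
    have : ∑ s ∈ range (n + 1), Function.update l (n + 1) (d n - d (n + 1)) s * y s
        = ∑ s ∈ range (n + 1), l s * y s :=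
      sum_congr rfl fun s hs => by
        rw [Function.update_of_ne (by have := mem_range.1 hs; omega)]
    rw [this, Function.update_self]
    ring

/-- The newest value enters with coefficient `c_0 ≥ 1`; Young and Cauchy–Schwarz absorb the older
values. The constant depends on `j`, so this serves finitely many levels only. -/
theorem exists_timeForm_ge {α : ℝ} (hα : 0 < α) (hα' : α < 1) (j : ℕ) : ∃ K : ℝ, 0 ≤ K ∧
    ∀ y : ℕ → ℝ, 1 / 2 * y (j + 1) ^ 2 - K * ∑ s ∈ range (j + 1), y s ^ 2 ≤ timeForm α y j := by
  obtain ⟨l, hl⟩ := exists_sum_mul_sub_eq (fun s => c α j (j - s)) j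
  refine ⟨1 / 2 * ∑ s ∈ range (j + 1), l s ^ 2, by positivity, fun y => ?_⟩
  rw [timeForm, hl y]
  simp only [Nat.sub_self]
  have h1 := mul_le_mul_of_nonneg_right (one_le_c_zero hα hα' j) (sq_nonneg (y (j + 1)))
  have h2 := sum_mul_sq_le_sq_mul_sq (range (j + 1)) l y
  nlinarith [sq_nonneg (y (j + 1) + ∑ s ∈ range (j + 1), l s * y s)]

/-! ### The space operator: signs, row sums, square root. -/

theorem g_neg (β : ℝ) (k : ℤ) : g β (-k) = g β k := by
  unfold g
  have : (-1 : ℝ) ^ (-k) = (-1 : ℝ) ^ k := by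
    rw [zpow_neg, ← inv_zpow]
    norm_num
  rw [this, mul_comm (Real.Gamma (β / 2 - k + 1))]
  push_cast
  rw [sub_neg_eq_add, ← sub_eq_add_neg]

theorem g_zero_pos {β : ℝ} (hβ : 1 < β) : 0 < g β 0 := by
  have h1 := Real.Gamma_pos_of_pos (show 0 < 1 + β by linarith)
  have h2 := Real.Gamma_pos_of_pos (show 0 < β / 2 + 1 by linarith)
  simp only [g, zpow_zero, Int.cast_zero, sub_zero, add_zero]
  positivity

theorem g_succ {β : ℝ} (hβ : 1 < β) (k : ℕ) :
    (k + 1 + β / 2) * g β ((k : ℤ) + 1) = (k - β / 2) * g β k := by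
  have hk : (0 : ℝ) ≤ k := Nat.cast_nonneg k
  have hp : (0 : ℝ) < β / 2 + k + 1 := by linarith
  have e1 : Real.Gamma (β / 2 + ((k : ℝ) + 1) + 1)
      = (β / 2 + k + 1) * Real.Gamma (β / 2 + k + 1) := by
    rw [← Real.Gamma_add_one hp.ne']; ring_nf
  have hG := Real.Gamma_pos_of_pos hp
  unfold g
  push_cast
  rw [e1, zpow_add_one₀ (by norm_num)]
  -- At this pole (`β = 2`, `k = 1`) the convention `Γ(0) = 0` makes the left side vanish, and the
  -- right factor is zero.
  by_cases h : β / 2 - k = 0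
  · have h1 : β / 2 - ((k : ℝ) + 1) + 1 = 0 := by linarith
    rw [h1, Real.Gamma_zero, show (k : ℝ) - β / 2 = 0 by linarith]
    simp
  · have e2 : Real.Gamma (β / 2 - k + 1) = (β / 2 - k) * Real.Gamma (β / 2 - k) :=
      Real.Gamma_add_one h
    rw [e2, show β / 2 - ((k : ℝ) + 1) + 1 = β / 2 - k by ring]
    by_cases h2 : Real.Gamma (β / 2 - k) = 0
    · simp [h2]
    · rw [show (k : ℝ) + 1 + β / 2 = β / 2 + k + 1 by ring,
        show (k : ℝ) - β / 2 = -(β / 2 - k) by ring]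
      generalize β / 2 - (k : ℝ) = d at h h2 ⊢
      generalize β / 2 + (k : ℝ) + 1 = e at hp hG ⊢
      field_simp

theorem g_nonpos {β : ℝ} (hβ : 1 < β) (hβ' : β ≤ 2) (k : ℕ) : g β ((k : ℤ) + 1) ≤ 0 := by
  induction k with
  | zero =>
    have h := g_succ hβ 0
    have h0 := g_zero_pos hβ
    simp only [Nat.cast_zero, zero_add, zero_sub] at h ⊢
    have h1 : 0 < 1 + β / 2 := by linarith
    by_contra hc
    push Not at hc
    nlinarith [mul_pos h1 hc, mul_pos (show 0 < β / 2 by linarith) h0]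
  | succ k ih =>
    have h := g_succ hβ (k + 1)
    push_cast at h ⊢
    have hk : (0 : ℝ) ≤ k := Nat.cast_nonneg k
    have h1 : 0 < (k : ℝ) + 1 + 1 + β / 2 := by linarith
    have h2 : ((k : ℝ) + 1 - β / 2) * g β ((k : ℤ) + 1) ≤ 0 :=
      mul_nonpos_of_nonneg_of_nonpos (by linarith) ih
    by_contra hc
    push Not at hc
    have := mul_pos h1 hc
    linarith

theorem g_nonpos_of_ne {β : ℝ} (hβ : 1 < β) (hβ' : β ≤ 2) {k : ℤ} (hk : k ≠ 0) : g β k ≤ 0 := by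
  have key : ∀ n : ℕ, n ≠ 0 → g β n ≤ 0 := by
    intro n hn
    obtain ⟨m, rfl⟩ := Nat.exists_eq_succ_of_ne_zero hn
    simpa using g_nonpos hβ hβ' m
  rcases Int.eq_nat_or_neg k with ⟨n, rfl | rfl⟩
  · exact key n (by simpa using hk)
  · rw [g_neg]
    exact key n (by simpa using hk)

/-- The recurrence `g_succ` makes the symmetric partial sums telescope to a closed form, whose sign
can be read off. -/
theorem mul_sum_g {β : ℝ} (hβ : 1 < β) (n : ℕ) :
    β * (g β 0 + 2 * ∑ k ∈ range n, g β ((k : ℤ) + 1)) = 2 * (β / 2 - n) * g β n := by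
  induction n with
  | zero =>
    simp only [range_zero, sum_empty, Nat.cast_zero]
    ring
  | succ n ih =>
    rw [sum_range_succ]
    have := g_succ hβ n
    push_cast
    linarith

theorem sum_g_nonneg {β : ℝ} (hβ : 1 < β) (hβ' : β ≤ 2) (n : ℕ) :
    0 ≤ g β 0 + 2 * ∑ k ∈ range n, g β ((k : ℤ) + 1) := by
  have h : 0 ≤ 2 * (β / 2 - n) * g β n := by
    rcases n with _ | n
    · have := g_zero_pos hβ
      push_cast
      have : 0 < 2 * (β / 2 - 0) * g β 0 := mul_pos (by linarith) this
      exact this.le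
    · have := g_nonpos hβ hβ' n
      push_cast
      have hn : (0 : ℝ) ≤ n := Nat.cast_nonneg n
      exact mul_nonneg_of_nonpos_of_nonpos (by linarith) this
  rw [← mul_sum_g hβ n] at h
  exact nonneg_of_mul_nonneg_right h (by linarith)

/-- Every row sum of the Toeplitz matrix `(g_{i-j})` is nonnegative. -/
theorem row_sum_g_nonneg {β : ℝ} (hβ : 1 < β) (hβ' : β ≤ 2) {n i : ℕ} (hi : i < n) :
    0 ≤ ∑ j ∈ range n, g β ((i : ℤ) - j) := by
  obtain ⟨m, rfl⟩ : ∃ m, n = (i + 1) + m := ⟨n - (i + 1), by omega⟩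
  rw [sum_range_add, sum_range_succ]
  have e1 : ∑ j ∈ range i, g β ((i : ℤ) - j) = ∑ k ∈ range i, g β ((k : ℤ) + 1) := by
    rw [← sum_range_reflect]
    refine sum_congr rfl fun j hj => ?_
    have := mem_range.1 hj
    congr 1
    omega
  have e2 : ∑ j ∈ range m, g β ((i : ℤ) - ((i + 1 + j : ℕ) : ℤ))
      = ∑ k ∈ range m, g β ((k : ℤ) + 1) := by
    refine sum_congr rfl fun j _ => ?_
    rw [← g_neg]
    congr 1
    push_cast
    ring
  rw [e1, e2, sub_self]
  -- A row sum is the mean of two symmetric partial sums, one for each side of the diagonal.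
  linarith [sum_g_nonneg hβ hβ' i, sum_g_nonneg hβ hβ' m]

/-- A symmetric matrix with nonpositive off-diagonal entries and nonnegative row sums is
positive semidefinite. -/
theorem posSemidef_of_row_sum_nonneg {n : ℕ} {A : Matrix (Fin n) (Fin n) ℝ}
    (hs : ∀ i j, A i j = A j i) (ho : ∀ i j, i ≠ j → A i j ≤ 0) (hr : ∀ i, 0 ≤ ∑ j, A i j) :
    A.PosSemidef := by
  refine Matrix.PosSemidef.of_dotProduct_mulVec_nonneg ?_ ?_
  · ext i j
    simp [hs j i]
  intro x
  have e : star x ⬝ᵥ A.mulVec x = ∑ i, ∑ j, A i j * (x i * x j) := by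
    simp only [dotProduct, Matrix.mulVec, mul_sum]
    refine sum_congr rfl fun i _ => sum_congr rfl fun j _ => ?_
    simp
    ring
  have e1 : ∑ i, ∑ j, A i j * x i ^ 2 = ∑ i, (∑ j, A i j) * x i ^ 2 :=
    sum_congr rfl fun i _ => (sum_mul _ _ _).symm
  have e2 : ∑ i, ∑ j, A i j * x j ^ 2 = ∑ i, (∑ j, A i j) * x i ^ 2 := by
    rw [sum_comm, ← e1]
    exact sum_congr rfl fun i _ => sum_congr rfl fun j _ => by rw [hs]
  have e3 : ∑ i, ∑ j, A i j * (x i * x j) = ∑ i, (∑ j, A i j) * x i ^ 2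
      - 1 / 2 * ∑ i, ∑ j, A i j * (x i - x j) ^ 2 := by
    have : ∑ i, ∑ j, A i j * (x i - x j) ^ 2 = ∑ i, ∑ j, A i j * x i ^ 2
        + ∑ i, ∑ j, A i j * x j ^ 2 - 2 * ∑ i, ∑ j, A i j * (x i * x j) := by
      simp only [mul_sum, ← sum_add_distrib, ← sum_sub_distrib]
      exact sum_congr rfl fun i _ => sum_congr rfl fun j _ => by ring
    rw [e1, e2] at this
    linarith
  rw [e, e3]
  have h1 : 0 ≤ ∑ i, (∑ j, A i j) * x i ^ 2 :=
    sum_nonneg fun i _ => mul_nonneg (hr i) (sq_nonneg _)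
  have h2 : ∑ i, ∑ j, A i j * (x i - x j) ^ 2 ≤ 0 := by
    refine sum_nonpos fun i _ => sum_nonpos fun j _ => ?_
    by_cases h : i = j
    · simp [h]
    · exact mul_nonpos_of_nonpos_of_nonneg (ho i j h) (sq_nonneg _)
  linarith

theorem negDeltaXMatrix_posSemidef {β h : ℝ} (hβ : 1 < β) (hβ' : β ≤ 2) (hh : 0 ≤ h) (N : ℕ) :
    (negDeltaXMatrix β h N).PosSemidef := by
  have hp : 0 ≤ h ^ (-β) := Real.rpow_nonneg hh _
  refine posSemidef_of_row_sum_nonneg ?_ ?_ ?_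
  · intro i j
    simp only [negDeltaXMatrix, Matrix.of_apply]
    rw [← g_neg, neg_sub]
  · intro i j hij
    simp only [negDeltaXMatrix, Matrix.of_apply]
    refine mul_nonpos_of_nonneg_of_nonpos hp (g_nonpos_of_ne hβ hβ' ?_)
    have : (i : ℕ) ≠ j := fun h => hij (Fin.ext h)
    omega
  · intro i
    simp only [negDeltaXMatrix, Matrix.of_apply]
    rw [← mul_sum, Fin.sum_univ_eq_sum_range (fun j => g β (((i : ℕ) : ℤ) - (j : ℤ))) (N - 1)]
    exact mul_nonneg hp (row_sum_g_nonneg hβ hβ' i.2)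

open scoped MatrixOrder in
theorem Xi_posSemidef (β h : ℝ) (N : ℕ) : (Xi β h N).PosSemidef :=
  Matrix.nonneg_iff_posSemidef.1 (CFC.sqrt_nonneg _)

open scoped MatrixOrder in
theorem Xi_mul_self {β h : ℝ} (hβ : 1 < β) (hβ' : β ≤ 2) (hh : 0 ≤ h) (N : ℕ) :
    Xi β h N * Xi β h N = negDeltaXMatrix β h N :=
  CFC.sqrt_mul_sqrt_self _ (Matrix.nonneg_iff_posSemidef.2 (negDeltaXMatrix_posSemidef hβ hβ' hh N))

theorem discNorm_sq {h : ℝ} (hh : 0 ≤ h) {n : ℕ} (v : Fin n → ℝ) :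
    discNorm h v ^ 2 = h * ∑ i, v i ^ 2 := by
  have e : discInner h v v = h * ∑ i, v i ^ 2 := by simp only [discInner, sq]
  rw [discNorm, e, Real.sq_sqrt]
  exact mul_nonneg hh (sum_nonneg fun i _ => sq_nonneg _)

theorem discNorm_Xi_sq {β h : ℝ} (hβ : 1 < β) (hβ' : β ≤ 2) (hh : 0 ≤ h) (N : ℕ)
    (v : Fin (N - 1) → ℝ) :
    discNorm h ((Xi β h N).mulVec v) ^ 2
      = discInner h v ((negDeltaXMatrix β h N).mulVec v) := by
  have hs : (Xi β h N).transpose = Xi β h N := by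
    have := (Xi_posSemidef β h N).isHermitian
    rwa [Matrix.IsHermitian, Matrix.conjTranspose_eq_transpose_of_trivial] at this
  have e : (Xi β h N).mulVec v ⬝ᵥ (Xi β h N).mulVec v
      = v ⬝ᵥ (negDeltaXMatrix β h N).mulVec v := by
    rw [← Xi_mul_self hβ hβ' hh, ← Matrix.mulVec_mulVec, Matrix.dotProduct_mulVec v,
      ← Matrix.mulVec_transpose, hs]
  rw [discNorm_sq hh]
  simp only [discInner]
  congr 1
  simp only [dotProduct] at e
  rw [← e]
  exact sum_congr rfl fun i _ => sq _

/-! ### The abstract energy argument. -/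

/-- The energy relations between the squared norms `U j` of the solution, `X j` of its image
under the square root of the space operator, `F j` of the source, the summed time forms `Q j` and
the products `P j` of source and solution. -/
structure EnergyData (α κ T : ℝ) (K : ℕ → ℝ) (M : ℕ) (τ : ℝ) (U X F Q P : ℕ → ℝ) : Prop where
  pos : 0 < M
  step : τ = T / M
  U_nonneg : ∀ j, 0 ≤ U j
  X_nonneg : ∀ j, 0 ≤ X j
  F_nonneg : ∀ j, 0 ≤ F j
  energy : ∀ j ∈ Icc 1 (M - 1),
    τ ^ (-α) / Real.Gamma (2 - α) * Q j + κ * X (j + 1) = P j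
  young : ∀ ε, 0 < ε → ∀ j, P j ≤ ε * U (j + 1) + 1 / (4 * ε) * F (j + 1)
  form_ge : ∀ j, 1 / 2 * U (j + 1) - K j * ∑ s ∈ range (j + 1), U s ≤ Q j
  sum_form_ge : 4 ≤ M →
    (1 - α) / 4 * (M : ℝ) ^ (-α) * ∑ j ∈ Ico 4 M, U (j + 1)
        - (leadWeight α + 9 * bdfWeight α) * (U 1 + U 2 + U 3 + U 4)
        - 3 * (M : ℝ) ^ (1 - α) * (U 0 + U 1)
      ≤ ∑ j ∈ Ico 4 M, Q j

/-- The right-hand side of the a priori estimate. -/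
def dataNorm (M : ℕ) (τ : ℝ) (U F : ℕ → ℝ) : ℝ :=
  U 1 + U 0 + τ * ∑ j ∈ Icc 1 (M - 1), F (j + 1)

namespace EnergyData

variable {α κ T : ℝ} {K : ℕ → ℝ} {M : ℕ} {τ : ℝ} {U X F Q P : ℕ → ℝ}

theorem step_pos (hT : 0 < T) (H : EnergyData α κ T K M τ U X F Q P) : 0 < τ := by
  rw [H.step]
  exact div_pos hT (Nat.cast_pos.2 H.pos)

theorem step_le (hT : 0 < T) (H : EnergyData α κ T K M τ U X F Q P) : τ ≤ T := by
  rw [H.step]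
  exact div_le_self hT.le (by exact_mod_cast H.pos)

theorem sum_F_le (hT : 0 < T) (H : EnergyData α κ T K M τ U X F Q P) {S : Finset ℕ}
    (hS : S ⊆ Icc 1 (M - 1)) : τ * ∑ j ∈ S, F (j + 1) ≤ dataNorm M τ U F := by
  have h1 := sum_le_sum_of_subset_of_nonneg hS fun i _ _ => H.F_nonneg (i + 1)
  have h2 := mul_le_mul_of_nonneg_left h1 (H.step_pos hT).le
  have := H.U_nonneg 0
  have := H.U_nonneg 1
  unfold dataNorm
  linarith

theorem initial_le (hT : 0 < T) (H : EnergyData α κ T K M τ U X F Q P) :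
    U 0 + U 1 ≤ dataNorm M τ U F := by
  have := mul_nonneg (H.step_pos hT).le
    (sum_nonneg (s := Icc 1 (M - 1)) fun i _ => H.F_nonneg (i + 1))
  unfold dataNorm
  linarith

theorem dataNorm_nonneg (hT : 0 < T) (H : EnergyData α κ T K M τ U X F Q P) :
    0 ≤ dataNorm M τ U F := by
  have := H.initial_le hT
  have := H.U_nonneg 0
  have := H.U_nonneg 1
  linarith

/-- A bound for one time level in terms of the preceding ones. -/
theorem level_le (hα : 0 < α) (hα' : α < 1) (hT : 0 < T) {j : ℕ} (hK : 0 ≤ K j)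
    {D : ℝ} (H : EnergyData α κ T K M τ U X F Q P) (hj : j ∈ Icc 1 (M - 1))
    (hD : ∀ s ≤ j, τ ^ (1 - α) * U s ≤ D * dataNorm M τ U F) :
    τ ^ (1 - α) * U (j + 1) / (4 * Real.Gamma (2 - α)) + κ * (τ * X (j + 1))
      ≤ (K j * ((j + 1) * D) / Real.Gamma (2 - α) + Real.Gamma (2 - α) * T ^ α)
        * dataNorm M τ U F := by
  have hG : 0 < Real.Gamma (2 - α) := Real.Gamma_pos_of_pos (by linarith)
  have hτ := H.step_pos hT
  set G := Real.Gamma (2 - α) with hGdef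
  have hta : 0 < τ ^ (-α) := Real.rpow_pos_of_pos hτ _
  have e1 : τ ^ (1 - α) = τ * τ ^ (-α) := by
    rw [sub_eq_add_neg, Real.rpow_add hτ, Real.rpow_one]
  have e2 : 1 / (4 * (τ ^ (-α) / (4 * G))) = G * τ ^ α := by
    rw [Real.rpow_neg hτ.le]
    have : 0 < τ ^ α := Real.rpow_pos_of_pos hτ _
    field_simp
  have hE := H.energy j hj
  -- This choice absorbs half of the term `1/2 * U (j + 1)` of `form_ge`; the source then carries `G
  -- τ^α ≤ G T^α`.
  have hY := H.young (τ ^ (-α) / (4 * G)) (by positivity) j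
  rw [e2] at hY
  have hL := H.form_ge j
  have hSum : ∑ s ∈ range (j + 1), τ ^ (1 - α) * U s ≤ (j + 1) * D * dataNorm M τ U F := by
    refine (sum_le_card_nsmul _ _ (D * dataNorm M τ U F) fun s hs => hD s ?_).trans (le_of_eq ?_)
    · have := mem_range.1 hs; omega
    · rw [card_range, nsmul_eq_mul]; push_cast; ring
  rw [← mul_sum, e1] at hSum
  have hF : τ * F (j + 1) ≤ dataNorm M τ U F := by
    simpa using H.sum_F_le hT (S := {j}) (by simpa using hj)
  have hta2 : τ ^ α ≤ T ^ α := Real.rpow_le_rpow hτ.le (H.step_le hT) hα.le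
  have hZ := H.dataNorm_nonneg hT
  have k1 : τ ^ (-α) / G * τ * (1 / 2 * U (j + 1) - K j * ∑ s ∈ range (j + 1), U s)
      ≤ τ ^ (-α) / G * τ * Q j := mul_le_mul_of_nonneg_left hL (by positivity)
  have k2 : G * (τ ^ α * (τ * F (j + 1))) ≤ G * (T ^ α * dataNorm M τ U F) := by
    have := mul_nonneg hτ.le (H.F_nonneg (j + 1))
    gcongr
  have k3 := mul_le_mul_of_nonneg_left hSum (show 0 ≤ K j / G by positivity)
  have k4 := mul_le_mul_of_nonneg_left hY hτ.le
  rw [← hE] at k4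
  rw [e1]
  have i1 : τ * τ ^ (-α) * U (j + 1) / (4 * G)
      = τ ^ (-α) / G * τ * (1 / 2 * U (j + 1)) - τ * (τ ^ (-α) / (4 * G) * U (j + 1)) := by
    field_simp; ring
  have i2 : (K j * ((j + 1) * D) / G + G * T ^ α) * dataNorm M τ U F
      = K j / G * ((j + 1) * D * dataNorm M τ U F) + G * (T ^ α * dataNorm M τ U F) := by
    ring
  have i3 : K j / G * (τ * τ ^ (-α) * ∑ s ∈ range (j + 1), U s)
      = τ ^ (-α) / G * τ * (K j * ∑ s ∈ range (j + 1), U s) := by ring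
  rw [i1, i2]
  rw [i3] at k3
  linarith

end EnergyData

/-- The factor `τ^{1-α}` is what `τ` times the prefactor `τ^{-α}` of the time derivative leaves, so
no negative power of `τ` enters `D`. The bound on `X` starts at level 2, the first one governed by
the scheme. -/
theorem exists_levels_le {α κ T : ℝ} {K : ℕ → ℝ} (hα : 0 < α) (hα' : α < 1) (hκ : 0 < κ)
    (hT : 0 < T) (hK : ∀ j, 0 ≤ K j) (n : ℕ) : ∃ D : ℝ, 0 ≤ D ∧
      ∀ (M : ℕ) (τ : ℝ) (U X F Q P : ℕ → ℝ), EnergyData α κ T K M τ U X F Q P →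
        ∀ j ≤ n, j ≤ M → τ ^ (1 - α) * U j ≤ D * dataNorm M τ U F ∧
          (2 ≤ j → τ * X j ≤ D * dataNorm M τ U F) := by
  have hG : 0 < Real.Gamma (2 - α) := Real.Gamma_pos_of_pos (by linarith)
  have base : ∀ (M : ℕ) (τ : ℝ) (U X F Q P : ℕ → ℝ), EnergyData α κ T K M τ U X F Q P →
      ∀ j ≤ 1, τ ^ (1 - α) * U j ≤ T ^ (1 - α) * dataNorm M τ U F := by
    intro M τ U X F Q P H j hj
    have h1 := H.initial_le hT
    have h2 := H.U_nonneg 0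
    have h3 := H.U_nonneg 1
    have h4 : U j ≤ dataNorm M τ U F := by interval_cases j <;> linarith
    have h5 : τ ^ (1 - α) ≤ T ^ (1 - α) :=
      Real.rpow_le_rpow (H.step_pos hT).le (H.step_le hT) (by linarith)
    exact mul_le_mul h5 h4 (H.U_nonneg j) (by positivity)
  induction n with
  | zero =>
    refine ⟨T ^ (1 - α), by positivity, fun M τ U X F Q P H j hj _ => ⟨?_, fun h => by omega⟩⟩
    exact base M τ U X F Q P H j (by omega)
  | succ n ih =>
    rcases Nat.eq_zero_or_pos n with rfl | hn
    · refine ⟨T ^ (1 - α), by positivity, fun M τ U X F Q P H j hj _ => ⟨?_, fun h => by omega⟩⟩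
      exact base M τ U X F Q P H j (by omega)
    obtain ⟨D, hD0, hD⟩ := ih
    set B := K n * ((n + 1) * D) / Real.Gamma (2 - α) + Real.Gamma (2 - α) * T ^ α with hB
    have hB0 : 0 ≤ B := by
      have := hK n
      positivity
    refine ⟨D + 4 * Real.Gamma (2 - α) * B + B / κ, by positivity,
      fun M τ U X F Q P H j hj hjM => ?_⟩
    have hZ := H.dataNorm_nonneg hT
    have hτ := H.step_pos hT
    have t1 : 0 ≤ D * dataNorm M τ U F := by positivity
    have t2 : 0 ≤ 4 * Real.Gamma (2 - α) * B * dataNorm M τ U F := by positivity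
    have t3 : 0 ≤ B / κ * dataNorm M τ U F := by positivity
    rw [add_mul, add_mul]
    rcases Nat.lt_or_ge n j with h | h
    · obtain rfl : j = n + 1 := by omega
      have hl := H.level_le hα hα' hT (j := n) (hK n) (D := D)
        (mem_Icc.2 ⟨hn, by omega⟩)
        (fun s hs => (hD M τ U X F Q P H s hs (by omega)).1)
      rw [← hB] at hl
      have u1 : 0 ≤ τ ^ (1 - α) * U (n + 1) / (4 * Real.Gamma (2 - α)) := by
        have := H.U_nonneg (n + 1)
        positivity
      have u2 : 0 ≤ κ * (τ * X (n + 1)) := by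
        have := H.X_nonneg (n + 1)
        positivity
      constructor
      · have : τ ^ (1 - α) * U (n + 1) / (4 * Real.Gamma (2 - α)) ≤ B * dataNorm M τ U F := by
          linarith
        rw [div_le_iff₀ (by positivity)] at this
        linarith
      · intro _
        have : κ * (τ * X (n + 1)) ≤ B * dataNorm M τ U F := by linarith
        have : τ * X (n + 1) ≤ B * dataNorm M τ U F / κ := by
          rw [le_div_iff₀ hκ]; linarith
        rw [mul_div_right_comm] at this
        linarith
    · have := hD M τ U X F Q P H j h hjM
      exact ⟨by linarith [this.1], fun h2 => by linarith [this.2 h2]⟩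

theorem EnergyData.sum_tail_le {α κ T : ℝ} {K : ℕ → ℝ} {M : ℕ} {τ : ℝ} {U X F Q P : ℕ → ℝ}
    (hα : 0 < α) (hα' : α < 1) (hT : 0 < T) {D ε : ℝ}
    (hε : ε = (1 - α) / 8 * T ^ (-α) / Real.Gamma (2 - α))
    (H : EnergyData α κ T K M τ U X F Q P) (hM : 4 ≤ M)
    (hD : ∀ s ≤ 4, τ ^ (1 - α) * U s ≤ D * dataNorm M τ U F) :
    ε * (τ * ∑ j ∈ Ico 4 M, U (j + 1)) + κ * (τ * ∑ j ∈ Ico 4 M, X (j + 1))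
      ≤ (((leadWeight α + 9 * bdfWeight α) * (4 * D) + 3 * T ^ (1 - α)) / Real.Gamma (2 - α)
        + 1 / (4 * ε)) * dataNorm M τ U F := by
  have hG : 0 < Real.Gamma (2 - α) := Real.Gamma_pos_of_pos (by linarith)
  have hτ := H.step_pos hT
  set G := Real.Gamma (2 - α) with hGdef
  have hq : 0 < 1 - α := by linarith
  have hε0 : 0 < ε := by rw [hε]; positivity
  have hM0 : (0 : ℝ) < M := Nat.cast_pos.2 H.pos
  have hTM : T = τ * M := by rw [H.step]; field_simp
  have e1 : τ ^ (1 - α) = τ * τ ^ (-α) := by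
    rw [sub_eq_add_neg, Real.rpow_add hτ, Real.rpow_one]
  have e2 : T ^ (-α) = τ ^ (-α) * (M : ℝ) ^ (-α) := by
    rw [hTM, Real.mul_rpow hτ.le hM0.le]
  have e3 : T ^ (1 - α) = τ ^ (1 - α) * (M : ℝ) ^ (1 - α) := by
    rw [hTM, Real.mul_rpow hτ.le hM0.le]
  have hsub : Ico 4 M ⊆ Icc 1 (M - 1) := fun j hj => by
    have := mem_Ico.1 hj
    exact mem_Icc.2 ⟨by omega, by omega⟩
  have hE : τ ^ (-α) / G * ∑ j ∈ Ico 4 M, Q j + κ * ∑ j ∈ Ico 4 M, X (j + 1)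
      = ∑ j ∈ Ico 4 M, P j := by
    rw [mul_sum, mul_sum, ← sum_add_distrib]
    exact sum_congr rfl fun j hj => H.energy j (hsub hj)
  have hY : ∑ j ∈ Ico 4 M, P j
      ≤ ε * ∑ j ∈ Ico 4 M, U (j + 1) + 1 / (4 * ε) * ∑ j ∈ Ico 4 M, F (j + 1) := by
    rw [mul_sum, mul_sum, ← sum_add_distrib]
    exact sum_le_sum fun j _ => H.young ε hε0 j
  have hF := H.sum_F_le hT hsub
  have hQ := mul_le_mul_of_nonneg_left (H.sum_form_ge hM)
    (show 0 ≤ τ ^ (1 - α) / G by positivity)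
  have hw : 0 ≤ leadWeight α + 9 * bdfWeight α := by
    have h1 := bdfWeight_nonneg hα hα'
    have h2 : 0 ≤ leadWeight α := by simpa [kern] using kern_nonneg hα hα' 0
    positivity
  have h1 : τ ^ (1 - α) * (U 1 + U 2 + U 3 + U 4) ≤ 4 * D * dataNorm M τ U F := by
    have h1 := hD 1 (by norm_num)
    have h2 := hD 2 (by norm_num)
    have h3 := hD 3 (by norm_num)
    have h4 := hD 4 (by norm_num)
    linarith
  have h1' := mul_le_mul_of_nonneg_left h1
    (show 0 ≤ (leadWeight α + 9 * bdfWeight α) / G by positivity)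
  have h2 := mul_le_mul_of_nonneg_left (H.initial_le hT) (show 0 ≤ 3 * T ^ (1 - α) / G by positivity)
  have hF' := mul_le_mul_of_nonneg_left hF (show 0 ≤ 1 / (4 * ε) by positivity)
  have hY' := mul_le_mul_of_nonneg_left hY hτ.le
  rw [← hE] at hY'
  -- By `T = τ M` the coercive coefficient is exactly `2 ε`; Young's inequality uses up one `ε`.
  have i1 : τ ^ (1 - α) / G * ((1 - α) / 4 * (M : ℝ) ^ (-α) * ∑ j ∈ Ico 4 M, U (j + 1)
        - (leadWeight α + 9 * bdfWeight α) * (U 1 + U 2 + U 3 + U 4)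
        - 3 * (M : ℝ) ^ (1 - α) * (U 0 + U 1))
      = 2 * ε * (τ * ∑ j ∈ Ico 4 M, U (j + 1))
        - (leadWeight α + 9 * bdfWeight α) / G * (τ ^ (1 - α) * (U 1 + U 2 + U 3 + U 4))
        - 3 * T ^ (1 - α) / G * (U 0 + U 1) := by
    rw [hε, e2, e3, e1]
    ring
  have i2 : τ ^ (1 - α) / G * ∑ j ∈ Ico 4 M, Q j
      = τ * (τ ^ (-α) / G * ∑ j ∈ Ico 4 M, Q j) := by
    rw [e1]; ring
  rw [i1, i2] at hQ
  have i3 : (((leadWeight α + 9 * bdfWeight α) * (4 * D) + 3 * T ^ (1 - α)) / G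
        + 1 / (4 * ε)) * dataNorm M τ U F
      = (leadWeight α + 9 * bdfWeight α) / G * (4 * D * dataNorm M τ U F)
        + 3 * T ^ (1 - α) / G * dataNorm M τ U F + 1 / (4 * ε) * dataNorm M τ U F := by
    ring
  rw [i3]
  linarith

theorem exists_sum_le {α κ T : ℝ} {K : ℕ → ℝ} (hα : 0 < α) (hα' : α < 1) (hκ : 0 < κ)
    (hT : 0 < T) (hK : ∀ j, 0 ≤ K j) : ∃ C : ℝ, 0 < C ∧
      ∀ (M : ℕ) (τ : ℝ) (U X F Q P : ℕ → ℝ), EnergyData α κ T K M τ U X F Q P →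
        τ * ∑ j ∈ Icc 1 (M - 1), (U (j + 1) + X (j + 1)) ≤ C * dataNorm M τ U F := by
  obtain ⟨D, hD0, hD⟩ := exists_levels_le hα hα' hκ hT hK 4
  have hG : 0 < Real.Gamma (2 - α) := Real.Gamma_pos_of_pos (by linarith)
  have hq : 0 < 1 - α := by linarith
  obtain ⟨ε, hε⟩ : ∃ ε, ε = (1 - α) / 8 * T ^ (-α) / Real.Gamma (2 - α) := ⟨_, rfl⟩
  have hε0 : 0 < ε := by rw [hε]; positivity
  have hw : 0 ≤ leadWeight α + 9 * bdfWeight α := by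
    have h1 := bdfWeight_nonneg hα hα'
    have h2 : 0 ≤ leadWeight α := by simpa [kern] using kern_nonneg hα hα' 0
    positivity
  set B := ((leadWeight α + 9 * bdfWeight α) * (4 * D) + 3 * T ^ (1 - α)) / Real.Gamma (2 - α)
        + 1 / (4 * ε) with hB
  have hB0 : 0 < B := by positivity
  refine ⟨3 * (T ^ α * D + D) + (B / ε + B / κ), by positivity, fun M τ U X F Q P H => ?_⟩
  have hZ := H.dataNorm_nonneg hT
  have hτ := H.step_pos hT
  have hDM := hD M τ U X F Q P H
  -- At most three early terms, bounded levelwise, and the tail, bounded by `sum_tail_le`.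
  rw [← sum_filter_add_sum_filter_not (Icc 1 (M - 1)) (· < 4), mul_add, add_mul]
  refine add_le_add ?_ ?_
  · rw [mul_sum]
    have hle : ∀ j ∈ (Icc 1 (M - 1)).filter (· < 4), τ * (U (j + 1) + X (j + 1))
        ≤ (T ^ α * D + D) * dataNorm M τ U F := by
      intro j hj
      obtain ⟨hj1, hj2⟩ := mem_filter.1 hj
      have hj1 := mem_Icc.1 hj1
      obtain ⟨h1, h2⟩ := hDM (j + 1) (by omega) (by omega)
      have h2 := h2 (by omega)
      have e : τ = τ ^ α * τ ^ (1 - α) := by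
        rw [← Real.rpow_add hτ]; simp
      have h3 : τ * U (j + 1) ≤ T ^ α * (D * dataNorm M τ U F) := by
        calc τ * U (j + 1) = τ ^ α * (τ ^ (1 - α) * U (j + 1)) := by
              rw [← mul_assoc, ← e]
          _ ≤ T ^ α * (D * dataNorm M τ U F) :=
            mul_le_mul (Real.rpow_le_rpow hτ.le (H.step_le hT) hα.le) h1
              (mul_nonneg (by positivity) (H.U_nonneg _)) (by positivity)
      linarith
    refine (sum_le_card_nsmul _ _ _ hle).trans ?_
    have hc : ((Icc 1 (M - 1)).filter (· < 4)).card ≤ 3 := by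
      refine (card_le_card (t := Icc 1 3) fun j hj => ?_).trans (by simp)
      obtain ⟨hj1, hj2⟩ := mem_filter.1 hj
      exact mem_Icc.2 ⟨(mem_Icc.1 hj1).1, by omega⟩
    have hc' : (((Icc 1 (M - 1)).filter (· < 4)).card : ℝ) ≤ 3 := by exact_mod_cast hc
    rw [nsmul_eq_mul, mul_assoc]
    exact mul_le_mul_of_nonneg_right hc' (by positivity)
  · have hset : (Icc 1 (M - 1)).filter (fun j => ¬ j < 4) = Ico 4 M := by
      ext j
      simp only [mem_filter, mem_Icc, mem_Ico]
      omega
    rw [hset]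
    rcases Nat.lt_or_ge M 4 with hM | hM
    · rw [Ico_eq_empty (by omega), sum_empty, mul_zero]
      positivity
    have h := H.sum_tail_le hα hα' hT hε hM fun s hs => (hDM s hs (by omega)).1
    rw [← hB] at h
    have u1 : 0 ≤ τ * ∑ j ∈ Ico 4 M, U (j + 1) :=
      mul_nonneg hτ.le (sum_nonneg fun j _ => H.U_nonneg _)
    have u2 : 0 ≤ τ * ∑ j ∈ Ico 4 M, X (j + 1) :=
      mul_nonneg hτ.le (sum_nonneg fun j _ => H.X_nonneg _)
    have v1 : τ * ∑ j ∈ Ico 4 M, U (j + 1) ≤ B * dataNorm M τ U F / ε := by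
      rw [le_div_iff₀ hε0]
      have := mul_nonneg hκ.le u2
      linarith
    have v2 : τ * ∑ j ∈ Ico 4 M, X (j + 1) ≤ B * dataNorm M τ U F / κ := by
      rw [le_div_iff₀ hκ]
      have := mul_nonneg hε0.le u1
      linarith
    rw [sum_add_distrib, mul_add, add_mul, ← mul_div_right_comm, ← mul_div_right_comm]
    linarith

/-! ### From the scheme to the energy relations. -/

theorem discInner_le {h ε : ℝ} (hh : 0 ≤ h) (hε : 0 < ε) {n : ℕ} (v w : Fin n → ℝ) :
    discInner h v w ≤ ε * discNorm h v ^ 2 + 1 / (4 * ε) * discNorm h w ^ 2 := by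
  rw [discNorm_sq hh, discNorm_sq hh, discInner]
  have : ∑ i, v i * w i ≤ ε * ∑ i, v i ^ 2 + 1 / (4 * ε) * ∑ i, w i ^ 2 := by
    rw [mul_sum, mul_sum, ← sum_add_distrib]
    refine sum_le_sum fun i _ => ?_
    have e : ε * v i ^ 2 + 1 / (4 * ε) * w i ^ 2 - v i * w i
        = (2 * ε * v i - w i) ^ 2 / (4 * ε) := by
      field_simp; ring
    have : 0 ≤ (2 * ε * v i - w i) ^ 2 / (4 * ε) := by positivity
    linarith
  have := mul_le_mul_of_nonneg_left this hh
  linarith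

theorem IsSolution.energy {α β κ xL xR T : ℝ} {N M : ℕ} {f : ℝ → ℝ → ℝ} {φ : ℝ → ℝ}
    {u : ℕ → ℕ → ℝ} (hu : IsSolution α β κ xL xR T N M f φ u) (hβ : 1 < β) (hβ' : β ≤ 2)
    (hN : 0 < N) {h τ : ℝ} (hh : h = (xR - xL) / N) (hτ : τ = T / M) (h0 : 0 ≤ h) {j : ℕ}
    (hj : j ∈ Icc 1 (M - 1)) :
    τ ^ (-α) / Real.Gamma (2 - α) * (h * ∑ i : Fin (N - 1), timeForm α (u ((i : ℕ) + 1)) j)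
        + κ * discNorm h ((Xi β h N).mulVec (uVec N u (j + 1))) ^ 2
      = discInner h (uVec N u (j + 1)) (fVec xL h τ N f (j + 1)) := by
  have hj := mem_Icc.1 hj
  rw [discNorm_Xi_sq hβ hβ' h0]
  have e : (negDeltaXMatrix β h N).mulVec (uVec N u (j + 1))
      = interior N (fun i => -deltaX β h N (fun m => u m (j + 1)) i) :=
    negDeltaXMatrix_mulVec β h hN (fun i => u i (j + 1)) (hu.boundary_left _ (by omega))
      (hu.boundary_right _ (by omega))
  rw [e]
  simp only [discInner, mul_sum]
  rw [← sum_add_distrib]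
  refine sum_congr rfl fun i _ => ?_
  have hs := hu.scheme ((i : ℕ) + 1) j (by omega) (by have := i.2; omega) hj.1 hj.2
  rw [← hh, ← hτ] at hs
  simp only [uVec, fVec, interior, timeForm]
  rw [deltaT] at hs
  have : f (xL + (((i : ℕ) + 1 : ℕ) : ℝ) * h) (((j + 1 : ℕ) : ℝ) * τ)
      = τ ^ (-α) / Real.Gamma (2 - α) * ∑ s ∈ range (j + 1), c α j (j - s) *
          (u ((i : ℕ) + 1) (s + 1) - u ((i : ℕ) + 1) s)
        - κ * deltaX β h N (fun m => u m (j + 1)) ((i : ℕ) + 1) := by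
    linarith
  rw [this]
  ring

theorem energyData_of_isSolution {α β κ xL xR T : ℝ} {N M : ℕ} {f : ℝ → ℝ → ℝ} {φ : ℝ → ℝ}
    {u : ℕ → ℕ → ℝ} (hα : 0 < α) (hα' : α < 1) (hβ : 1 < β) (hβ' : β ≤ 2)
    (hN : 0 < N) (hM : 0 < M) {h τ : ℝ} (hh : h = (xR - xL) / N) (hτ : τ = T / M) (h0 : 0 ≤ h)
    {K : ℕ → ℝ} (hK : ∀ (j : ℕ) (y : ℕ → ℝ),
      1 / 2 * y (j + 1) ^ 2 - K j * ∑ s ∈ range (j + 1), y s ^ 2 ≤ timeForm α y j)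
    (hu : IsSolution α β κ xL xR T N M f φ u) :
    EnergyData α κ T K M τ (fun j => discNorm h (uVec N u j) ^ 2)
      (fun j => discNorm h ((Xi β h N).mulVec (uVec N u j)) ^ 2)
      (fun j => discNorm h (fVec xL h τ N f j) ^ 2)
      (fun j => h * ∑ i : Fin (N - 1), timeForm α (u ((i : ℕ) + 1)) j)
      (fun j => discInner h (uVec N u (j + 1)) (fVec xL h τ N f (j + 1))) where
  pos := hM
  step := hτ
  U_nonneg _ := sq_nonneg _
  X_nonneg _ := sq_nonneg _
  F_nonneg _ := sq_nonneg _
  energy j hj := hu.energy hβ hβ' hN hh hτ h0 hj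
  young ε hε j := discInner_le h0 hε _ _
  form_ge j := by
    have e : ∀ j, discNorm h (uVec N u j) ^ 2 = h * ∑ i : Fin (N - 1), u ((i : ℕ) + 1) j ^ 2 :=
      fun j => discNorm_sq h0 _
    simp only [e]
    rw [← mul_sum, sum_comm]
    have := mul_le_mul_of_nonneg_left
      (sum_le_sum fun (i : Fin (N - 1)) (_ : i ∈ univ) => hK j (u ((i : ℕ) + 1))) h0
    rw [sum_sub_distrib, ← mul_sum, ← mul_sum] at this
    linarith
  sum_form_ge h4 := by
    have e : ∀ j, discNorm h (uVec N u j) ^ 2 = h * ∑ i : Fin (N - 1), u ((i : ℕ) + 1) j ^ 2 :=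
      fun j => discNorm_sq h0 _
    simp only [e]
    rw [← mul_sum, ← mul_sum, sum_comm, sum_comm (s := Ico 4 M)]
    have := mul_le_mul_of_nonneg_left
      (sum_le_sum fun (i : Fin (N - 1)) (_ : i ∈ univ) =>
        sum_timeForm_ge hα hα' (u ((i : ℕ) + 1)) h4) h0
    simp only [sum_sub_distrib, ← mul_sum, sum_add_distrib] at this
    linarith

end L2Scheme

end

theorem theorem2p1 (α β κ xL xR T : ℝ) (hα : 0 < α) (hα' : α < 1) (hβ : 1 < β) (hβ' : β ≤ 2)
    (hκ : 0 < κ) (hx : xL < xR) (hT : 0 < T) :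
    (∀ N : ℕ, 0 < N →
      (L2Scheme.Xi β ((xR - xL) / N) N).PosSemidef ∧
      L2Scheme.Xi β ((xR - xL) / N) N * L2Scheme.Xi β ((xR - xL) / N) N
        = L2Scheme.negDeltaXMatrix β ((xR - xL) / N) N) ∧
    ∃ C₁ : ℝ, 0 < C₁ ∧
      ∀ (N M : ℕ), 0 < N → 0 < M → ∀ (h τ : ℝ), h = (xR - xL) / N → τ = T / M →
      ∀ (f : ℝ → ℝ → ℝ) (φ : ℝ → ℝ) (u : ℕ → ℕ → ℝ),
        L2Scheme.IsSolution α β κ xL xR T N M f φ u →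
        τ * ∑ j ∈ Finset.Icc 1 (M - 1),
            (L2Scheme.discNorm h (L2Scheme.uVec N u (j + 1)) ^ 2
              + L2Scheme.discNorm h
                  ((L2Scheme.Xi β h N).mulVec (L2Scheme.uVec N u (j + 1))) ^ 2)
          ≤ C₁ * (L2Scheme.discNorm h (L2Scheme.uVec N u 1) ^ 2
              + L2Scheme.discNorm h (L2Scheme.uVec N u 0) ^ 2
              + τ * ∑ j ∈ Finset.Icc 1 (M - 1),
                  L2Scheme.discNorm h (L2Scheme.fVec xL h τ N f (j + 1)) ^ 2) := by
  have hh : ∀ N : ℕ, 0 ≤ (xR - xL) / (N : ℝ) := fun N =>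
    div_nonneg (by linarith) (Nat.cast_nonneg N)
  refine ⟨fun N _ => ⟨L2Scheme.Xi_posSemidef _ _ _, L2Scheme.Xi_mul_self hβ hβ' (hh N) N⟩, ?_⟩
  -- `K` is fixed before `N`, `M` and the data, so the final constant is uniform in them.
  choose K hK0 hK using L2Scheme.exists_timeForm_ge hα hα'
  obtain ⟨C, hC0, hC⟩ := L2Scheme.exists_sum_le hα hα' hκ hT hK0
  refine ⟨C, hC0, fun N M hN hM h τ hh' hτ f φ u hu => ?_⟩
  exact hC M τ _ _ _ _ _ (L2Scheme.energyData_of_isSolution hα hα' hβ hβ' hN hM hh' hτ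
    (hh' ▸ hh N) hK hu)
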